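/- For a nonzero polynomial $P\in\mathbb{Z}[x]$ of degree $d\ge 1$, let $I(P)$ and $E(P)$ be the numbers of complex zeros of $P$, counted with multiplicity, of modulus $<1$ and $>1$ respectively, and let $C(P)=\frac{I(P)+E(P)}{d}$ be the ratio between the number of nonunimodular zeros of $P$ and its degree. Let $m>1$ be an integer, put $l=m-1$, and for integers $n\ge 1$ let $$H_{2n+2m-2}(x)=x^{n+l}\Big(\sum_{j=0}^{l}\big(x^{n+j}+x^{-n-j}\big)+1\Big),$$ a reciprocal polynomial of degree $2n+2m-2$. With $\varphi_A(x)=(x^A-1)/(x-1)$ and the Boyd–Mossinghoff polynomials $P_{A,B}(x,y)=x^{\max(A-B,0)}\big(\varphi_A(x)+\varphi_B(x)y+x^{B-A}\varphi_A(x)y^2\big)$, one has $x^{l}H_{2n+2m-2}(x)=P_{m,1}(x,x^{n+l})$ for all $n$. Moreover the limit ratio $LC(H_{2n+2m-2})=\lim_{n\to\infty}C(H_{2n+2m-2})$ exists and satisfies $$\frac{2}{\pi(2m+1)}\cdot\frac{\sin\frac{(m-1)\pi}{2m}}{\sin\frac{\pi}{2m}}<LC(H_{2n+2m-2})<\frac{2}{6m-\pi}\cdot\frac{\sin\frac{(m-1)\pi}{2m}}{\sin\frac{\pi}{2m}}.$$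 -/

import Mathlib

open Polynomial

/-- `I(P)`: the number of complex zeros of `P` of modulus `< 1`, counted with multiplicity. -/
noncomputable def numZerosInside (P : ℤ[X]) : ℕ :=
  (P.aroots ℂ).countP (fun z => ‖z‖ < 1)

/-- `E(P)`: the number of complex zeros of `P` of modulus `> 1`, counted with multiplicity. -/
noncomputable def numZerosOutside (P : ℤ[X]) : ℕ :=
  (P.aroots ℂ).countP (fun z => 1 < ‖z‖)

/-- `C(P)`: the number of nonunimodular zeros of `P` divided by the degree of `P`. -/
noncomputable def nonunimodularRatio (P : ℤ[X]) : ℝ :=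
  ((numZerosInside P : ℝ) + (numZerosOutside P : ℝ)) / (P.natDegree : ℝ)

/-- The sequence `P` of polynomials has limit ratio `L`, that is, `C(P n)` tends to `L` as
`n` tends to infinity. -/
def HasLimitRatio (P : ℕ → ℤ[X]) (L : ℝ) : Prop :=
  Filter.Tendsto (fun n => nonunimodularRatio (P n)) Filter.atTop (nhds L)

/-- `H_{2n+2l}(x) = x^(n+l) (∑_{j=0}^{l} (x^(n+j) + x^(-n-j)) + 1)`, multiplied out: the exponent
`(n + l) - (n + j)` is a natural number because `j ≤ l`. -/
noncomputable def polyH (l n : ℕ) : ℤ[X] :=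
  ∑ j ∈ Finset.range (l + 1), (X ^ ((n + l) + (n + j)) + X ^ ((n + l) - (n + j))) + X ^ (n + l)

/-- The defining formula of `H_{2n+2l}` with its negative powers of `x`. -/
theorem aeval_polyH (l n : ℕ) {x : ℂ} (hx : x ≠ 0) :
    aeval x (polyH l n) =
      x ^ (n + l) * (∑ j ∈ Finset.range (l + 1), (x ^ (n + j) + 1 / x ^ (n + j)) + 1) := by
  simp only [polyH, map_add, map_sum, map_pow, aeval_X, mul_add, mul_one, Finset.mul_sum]
  congr 1
  refine Finset.sum_congr rfl fun j hj => ?_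
  have hj' : n + j ≤ n + l := by
    have := Finset.mem_range.1 hj
    omega
  rw [pow_add, pow_sub₀ x hx hj', one_div]

/-- `φ_A(x) = (x^A - 1) / (x - 1)`. -/
noncomputable def phiBM (A : ℕ) : ℤ[X] :=
  ∑ i ∈ Finset.range A, X ^ i

theorem phiBM_mul (A : ℕ) : phiBM A * (X - 1) = X ^ A - 1 :=
  geom_sum_mul X A

/-- The Boyd--Mossinghoff polynomial
`P_{A,B}(x,y) = x^(max(A-B,0)) (φ_A(x) + φ_B(x) y + x^(B-A) φ_A(x) y^2)`, as a polynomial in `y`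
with coefficients in `ℤ[x]`. Truncated subtraction is intended: `A - B` stands for `max(A-B,0)`,
and `max(A-B,0) + (B-A) = max(B-A,0)`. -/
noncomputable def boydMossinghoff (A B : ℕ) : ℤ[X][X] :=
  C (X ^ (A - B) * phiBM A) + C (X ^ (A - B) * phiBM B) * X + C (X ^ (B - A) * phiBM A) * X ^ 2

/-!
Write `l = m - 1` and `M = 2n + l`. On the unit circle, parametrized by `x = e^{2iu}` with `u` in
`[0, π)`, one has `H(x) = e^{2i(n+l)u} (2 cos (M u) D(u) + 1)`, where the amplitude
`D(u) = sin (m u) / sin u` does not depend on `n` (`aeval_polyH_exp`). The unimodular zeros of `H`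
are therefore the zeros of a rapid oscillation with a fixed amplitude.

Cut `[0, π]` into the `M` half-periods of `cos (M u)`. If `2 |D| > 1` on a half-period, the
oscillation changes sign there and has a zero; if `2 |D| < 1`, it has none. If `2 |D| ≥ 1 + δ` and
`M` is large, Rolle's theorem shows that the zero is unique and simple. On any half-period a second
application of Rolle's theorem bounds the number of zeros, and their multiplicity is at most two,
since the second derivative does not vanish near a zero. These facts are
`IsBoundedAmplitude.exists_finset_zeros` and `IsBoundedAmplitude.sum_multiplicities_le`. The number
of half-periods that meet a compact set `K` is at most about `M |K| / π`
(`eventually_card_meetingIndices_le`), and the level set `2 |D| = 1` is null because `D` is analytic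
and not constant. So the proportion of nonunimodular zeros tends to the normalized measure of
`{u ∈ [0, π] | 2 |D(u)| ≤ 1}` (`hasLimitRatio_polyH`).

This set, where essentially `2 |sin (m u)| ≤ sin u`, is located near the zeros `a = kπ/m` of
`sin (m u)`. With `v = u - a`, the chord bound for the sine on `[0, π/6]` gives
`(6m/π) |v| ≤ sin a + |cos a| |v|` on the set; conversely `(2m + c) |v| ≤ sin a` suffices for some
`c < 1`. Both bounds on the measure of the set follow by summing over `k`, as
`∑ sin (kπ/m) = cot (π/(2m))`.
-/

/-! ### Zeros of an oscillation with a given amplitude -/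

/-- `D` is twice differentiable on the real line, with derivatives `D₁` and `D₂`, and all three are
bounded by `C` in absolute value. -/
structure IsBoundedAmplitude (D D₁ D₂ : ℝ → ℝ) (C : ℝ) : Prop where
  hasDerivAt : ∀ u, HasDerivAt D (D₁ u) u
  hasDerivAt₁ : ∀ u, HasDerivAt D₁ (D₂ u) u
  bound : ∀ u, |D u| ≤ C
  bound₁ : ∀ u, |D₁ u| ≤ C
  bound₂ : ∀ u, |D₂ u| ≤ C

/-- The oscillation `2 cos (M u) D(u) + 1` with amplitude `D` and frequency `M`. -/
noncomputable def oscCos (D : ℝ → ℝ) (M u : ℝ) : ℝ := 2 * Real.cos (M * u) * D u + 1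

/-- The derivative of `oscCos D M` when `D₁` is the derivative of `D`. -/
noncomputable def oscCos₁ (D D₁ : ℝ → ℝ) (M u : ℝ) : ℝ :=
  -2 * M * Real.sin (M * u) * D u + 2 * Real.cos (M * u) * D₁ u

/-- The second derivative of `oscCos D M` when `D₁`, `D₂` are those of `D`. -/
noncomputable def oscCos₂ (D D₁ D₂ : ℝ → ℝ) (M u : ℝ) : ℝ :=
  -2 * M ^ 2 * Real.cos (M * u) * D u - 4 * M * Real.sin (M * u) * D₁ u
    + 2 * Real.cos (M * u) * D₂ u

namespace IsBoundedAmplitude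

variable {D D₁ D₂ : ℝ → ℝ} {C M : ℝ}

theorem hasDerivAt_oscCos (h : IsBoundedAmplitude D D₁ D₂ C) (M u : ℝ) :
    HasDerivAt (oscCos D M) (oscCos₁ D D₁ M u) u := by
  have hM : HasDerivAt (fun u : ℝ => M * u) M u := by simpa using (hasDerivAt_id u).const_mul M
  have := ((hM.cos.const_mul 2).mul (h.hasDerivAt u)).add_const 1
  refine this.congr_deriv ?_
  simp only [oscCos₁]; ring

theorem hasDerivAt_oscCos₁ (h : IsBoundedAmplitude D D₁ D₂ C) (M u : ℝ) :
    HasDerivAt (oscCos₁ D D₁ M) (oscCos₂ D D₁ D₂ M u) u := by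
  have hM : HasDerivAt (fun u : ℝ => M * u) M u := by simpa using (hasDerivAt_id u).const_mul M
  have := ((hM.sin.const_mul (-2 * M)).mul (h.hasDerivAt u)).add
    ((hM.cos.const_mul 2).mul (h.hasDerivAt₁ u))
  refine this.congr_deriv ?_
  simp only [oscCos₂]; ring

theorem nonneg (h : IsBoundedAmplitude D D₁ D₂ C) : 0 ≤ C := (abs_nonneg _).trans (h.bound 0)

theorem continuous (h : IsBoundedAmplitude D D₁ D₂ C) : Continuous D :=
  continuous_iff_continuousAt.2 fun u => (h.hasDerivAt u).continuousAt

theorem abs_cos_mul_le {x y B : ℝ} (h : |y| ≤ B) : |Real.cos x * y| ≤ B := by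
  rw [abs_mul]
  exact (mul_le_of_le_one_left (abs_nonneg _) (Real.abs_cos_le_one x)).trans h

theorem abs_sin_mul_le {x y B : ℝ} (h : |y| ≤ B) : |Real.sin x * y| ≤ B := by
  rw [abs_mul]
  exact (mul_le_of_le_one_left (abs_nonneg _) (Real.abs_sin_le_one x)).trans h

theorem abs_oscCos₁_le (h : IsBoundedAmplitude D D₁ D₂ C) (hM : 1 ≤ M) (u : ℝ) :
    |oscCos₁ D D₁ M u| ≤ 4 * C * M := by
  have h1 := abs_le.1 (abs_sin_mul_le (x := M * u) (h.bound u))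
  have h2 := abs_le.1 (abs_cos_mul_le (x := M * u) (h.bound₁ u))
  have := h.nonneg
  simp only [oscCos₁]
  rw [abs_le]
  constructor <;> nlinarith

/-- Where the oscillating term is not small, the second derivative does not vanish, because its
leading part is `-M²` times the oscillating term. -/
theorem oscCos₂_ne_zero (h : IsBoundedAmplitude D D₁ D₂ C) (hM1 : 1 ≤ M) (hM : 20 * C ≤ M)
    {u : ℝ} (hu : 1 / 4 ≤ |Real.cos (M * u) * D u|) : oscCos₂ D D₁ D₂ M u ≠ 0 := by
  intro h0
  have h1 := abs_le.1 (abs_sin_mul_le (x := M * u) (h.bound₁ u))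
  have h2 := abs_le.1 (abs_cos_mul_le (x := M * u) (h.bound₂ u))
  have hC := h.nonneg
  have hCM : 20 * C * M ≤ M * M := by nlinarith
  have hCM' : C ≤ C * M := by nlinarith
  simp only [oscCos₂] at h0
  have e : 2 * M ^ 2 * (Real.cos (M * u) * D u) =
      - (4 * M * (Real.sin (M * u) * D₁ u)) + 2 * (Real.cos (M * u) * D₂ u) := by linarith
  have e1 : |2 * M ^ 2 * (Real.cos (M * u) * D u)| ≤ 6 * (C * M) := by
    rw [e, abs_le]
    constructor <;> nlinarith
  rw [abs_mul, abs_of_nonneg (by positivity)] at e1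
  nlinarith

theorem abs_cos_mul_eq_half {u : ℝ} (hu : oscCos D M u = 0) :
    |Real.cos (M * u) * D u| = 1 / 2 := by
  simp only [oscCos] at hu
  have : Real.cos (M * u) * D u = -(1 / 2) := by linarith
  rw [this, abs_neg, abs_of_nonneg (by norm_num)]

theorem oscCos₂_ne_zero_of_zero (h : IsBoundedAmplitude D D₁ D₂ C) (hM1 : 1 ≤ M)
    (hM : 20 * C ≤ M) {u : ℝ} (hu : oscCos D M u = 0) :
    oscCos₂ D D₁ D₂ M u ≠ 0 :=
  h.oscCos₂_ne_zero hM1 hM (by rw [abs_cos_mul_eq_half hu]; norm_num)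

/-- An interval much shorter than a period contains at most two zeros of the oscillation: with
three, Rolle's theorem gives a zero of the second derivative near a zero of the oscillation. -/
theorem not_three_zeros (h : IsBoundedAmplitude D D₁ D₂ C) (hM1 : 1 ≤ M) (hM : 20 * C ≤ M)
    {a b c : ℝ} (hab : a < b) (hbc : b < c) (hac : 8 * C * M * (c - a) ≤ 1)
    (ha : oscCos D M a = 0) (hb : oscCos D M b = 0) (hc : oscCos D M c = 0) :
    False := by
  have cont : Continuous (oscCos D M) := continuous_iff_continuousAt.2 fun u =>
    (h.hasDerivAt_oscCos M u).continuousAt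
  have cont₁ : Continuous (oscCos₁ D D₁ M) := continuous_iff_continuousAt.2 fun u =>
    (h.hasDerivAt_oscCos₁ M u).continuousAt
  obtain ⟨x, hx, hx0⟩ := exists_hasDerivAt_eq_zero hab cont.continuousOn (ha.trans hb.symm)
    fun u _ => h.hasDerivAt_oscCos M u
  obtain ⟨y, hy, hy0⟩ := exists_hasDerivAt_eq_zero hbc cont.continuousOn (hb.trans hc.symm)
    fun u _ => h.hasDerivAt_oscCos M u
  obtain ⟨z, hz, hz0⟩ := exists_hasDerivAt_eq_zero (hx.2.trans hy.1) cont₁.continuousOn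
    (hx0.trans hy0.symm) fun u _ => h.hasDerivAt_oscCos₁ M u
  refine h.oscCos₂_ne_zero hM1 hM ?_ hz0
  have haz : a < z := hx.1.trans hz.1
  have hzc : z < c := hz.2.trans hy.2
  have key := Convex.norm_image_sub_le_of_norm_hasDerivWithin_le (s := Set.univ)
    (fun u _ => (h.hasDerivAt_oscCos M u).hasDerivWithinAt)
    (fun u _ => by simpa using h.abs_oscCos₁_le hM1 u) convex_univ
    (Set.mem_univ a) (Set.mem_univ z)
  rw [ha, sub_zero, Real.norm_eq_abs, Real.norm_eq_abs, abs_of_pos (sub_pos.2 haz)] at key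
  have hCM : 0 ≤ C * M := mul_nonneg h.nonneg (by linarith)
  have key2 : |oscCos D M z| ≤ 1 / 2 := key.trans (by nlinarith)
  simp only [oscCos] at key2
  have := abs_le.1 key2
  rw [abs_of_nonpos (by nlinarith)]
  linarith

/-- At a zero of the oscillation where the amplitude is large, the phase is away from the extrema of
the cosine. -/
theorem sin_sq_ge {δ u : ℝ} (hδ : 0 < δ) (hu : oscCos D M u = 0) (hD : 1 + δ ≤ 2 * |D u|) :
    1 - ((1 + δ)⁻¹) ^ 2 ≤ Real.sin (M * u) ^ 2 := by
  have h1 := abs_cos_mul_eq_half hu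
  rw [abs_mul] at h1
  have h2 : |Real.cos (M * u)| ≤ (1 + δ)⁻¹ := by
    rw [inv_eq_one_div, le_div_iff₀ (by linarith)]
    nlinarith [abs_nonneg (Real.cos (M * u))]
  have h3 : Real.cos (M * u) ^ 2 ≤ ((1 + δ)⁻¹) ^ 2 := by
    rw [← sq_abs]; gcongr
  linarith [Real.sin_sq_add_cos_sq (M * u)]

/-- A critical point of the oscillation is close to an extremum of the cosine. -/
theorem abs_sin_le_of_critical (h : IsBoundedAmplitude D D₁ D₂ C) {u : ℝ} (hM : 0 < M)
    (hu : oscCos₁ D D₁ M u = 0) (hD : 1 ≤ 2 * |D u|) :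
    |Real.sin (M * u)| * M ≤ 2 * C := by
  have h2 := abs_cos_mul_le (x := M * u) (h.bound₁ u)
  simp only [oscCos₁] at hu
  have e : Real.cos (M * u) * D₁ u = M * (Real.sin (M * u) * D u) := by linarith
  rw [e, abs_mul, abs_mul, abs_of_pos hM] at h2
  have := abs_nonneg (Real.sin (M * u))
  have h3 : 0 ≤ |Real.sin (M * u)| * M := by positivity
  nlinarith

theorem oscCos₁_ne_zero (h : IsBoundedAmplitude D D₁ D₂ C) {δ u : ℝ} (hδ : 0 < δ)
    (hM : 0 < M) (hCM : 2 * C < M * √(1 - ((1 + δ)⁻¹) ^ 2)) (hu : oscCos D M u = 0)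
    (hD : 1 + δ ≤ 2 * |D u|) : oscCos₁ D D₁ M u ≠ 0 := by
  intro h0
  have h1 := h.abs_sin_le_of_critical hM h0 (by linarith)
  have h2 := Real.sqrt_le_sqrt (sin_sq_ge hδ hu hD)
  rw [Real.sqrt_sq_eq_abs] at h2
  nlinarith

/-- On a half-period the modulus of the sine is concave, so it is at least its smaller end value. -/
theorem min_abs_sin_le (k : ℕ) {x y z : ℝ} (hx : x ∈ Set.Icc (k * Real.pi) ((k + 1) * Real.pi))
    (hy : y ∈ Set.Icc (k * Real.pi) ((k + 1) * Real.pi)) (hz : z ∈ Set.Icc x y) :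
    min |Real.sin x| |Real.sin y| ≤ |Real.sin z| := by
  have shift : ∀ w ∈ Set.Icc (k * Real.pi) ((k + 1) * Real.pi),
      |Real.sin w| = Real.sin (w - k * Real.pi) ∧ w - k * Real.pi ∈ Set.Icc 0 Real.pi := by
    intro w hw
    have hw' : w - k * Real.pi ∈ Set.Icc 0 Real.pi :=
      ⟨by linarith [hw.1], by linarith [hw.2]⟩
    refine ⟨?_, hw'⟩
    rw [← abs_of_nonneg (Real.sin_nonneg_of_mem_Icc hw'), Real.sin_sub_nat_mul_pi, abs_mul,
      abs_pow, abs_neg, abs_one, one_pow, one_mul]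
  have hz' : z ∈ Set.Icc (k * Real.pi) ((k + 1) * Real.pi) :=
    ⟨hx.1.trans hz.1, hz.2.trans hy.2⟩
  rw [(shift x hx).1, (shift y hy).1, (shift z hz').1]
  exact strictConcaveOn_sin_Icc.concaveOn.min_le_of_mem_Icc (shift x hx).2 (shift y hy).2
    ⟨by linarith [hz.1], by linarith [hz.2]⟩

/-- On a half-period on which the amplitude is large, the oscillation has at most one zero: a
critical point between two zeros would be close to an extremum of the cosine, and so would be one
of the two zeros. -/
theorem not_two_zeros (h : IsBoundedAmplitude D D₁ D₂ C) {δ a b : ℝ} (hδ : 0 < δ)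
    (hM : 0 < M) (hCM : 2 * C < M * √(1 - ((1 + δ)⁻¹) ^ 2)) (k : ℕ) (hab : a < b)
    (ha : k * Real.pi ≤ M * a) (hb : M * b ≤ (k + 1) * Real.pi)
    (ha0 : oscCos D M a = 0) (hb0 : oscCos D M b = 0)
    (hD : ∀ u ∈ Set.Icc a b, 1 + δ ≤ 2 * |D u|) : False := by
  have cont : Continuous (oscCos D M) := continuous_iff_continuousAt.2 fun u =>
    (h.hasDerivAt_oscCos M u).continuousAt
  obtain ⟨x, hx, hx0⟩ := exists_hasDerivAt_eq_zero hab cont.continuousOn (ha0.trans hb0.symm)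
    fun u _ => h.hasDerivAt_oscCos M u
  have h1 := h.abs_sin_le_of_critical hM hx0 (by linarith [hD x ⟨hx.1.le, hx.2.le⟩])
  have hMab : M * a ≤ M * b := by nlinarith
  have h2 := min_abs_sin_le k (x := M * a) (y := M * b) (z := M * x) ⟨ha, hMab.trans hb⟩
    ⟨ha.trans hMab, hb⟩ ⟨by nlinarith [hx.1], by nlinarith [hx.2]⟩
  have h3 := Real.sqrt_le_sqrt (sin_sq_ge hδ ha0 (hD a ⟨le_rfl, hab.le⟩))
  have h4 := Real.sqrt_le_sqrt (sin_sq_ge hδ hb0 (hD b ⟨hab.le, le_rfl⟩))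
  rw [Real.sqrt_sq_eq_abs] at h3 h4
  have h5 := (le_min h3 h4).trans h2
  nlinarith

/-- On a half-period on which the amplitude exceeds `1 / 2`, the oscillation takes values of
opposite signs at the end points. -/
theorem exists_zero (h : IsBoundedAmplitude D D₁ D₂ C) (hM : 0 < M) (k : ℕ)
    (hD : ∀ u ∈ Set.Icc (k * Real.pi / M) ((k + 1) * Real.pi / M), 1 < 2 * |D u|) :
    ∃ u ∈ Set.Ioo (k * Real.pi / M) ((k + 1) * Real.pi / M), oscCos D M u = 0 := by
  set a := k * Real.pi / M
  set b := (k + 1) * Real.pi / M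
  have hab : a < b := by
    have := Real.pi_pos
    simp only [a, b]; gcongr; linarith
  have ea : oscCos D M a = 2 * (-1) ^ k * D a + 1 := by
    rw [oscCos, show M * a = k * Real.pi by simp only [a]; field_simp, Real.cos_nat_mul_pi]
  have eb : oscCos D M b = -(2 * (-1) ^ k * D b) + 1 := by
    rw [oscCos, show M * b = ((k + 1 : ℕ) : ℝ) * Real.pi by simp only [b]; push_cast; field_simp,
      Real.cos_nat_mul_pi]
    ring
  have cont : ContinuousOn (oscCos D M) (Set.Icc a b) := fun u _ =>
    (h.hasDerivAt_oscCos M u).continuousAt.continuousWithinAt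
  -- the amplitude has no zero on the interval, hence a constant sign
  have hsign : (1 < 2 * D a ∧ 1 < 2 * D b) ∨ (2 * D a < -1 ∧ 2 * D b < -1) := by
    have h1 := hD a ⟨le_rfl, hab.le⟩
    have h2 := hD b ⟨hab.le, le_rfl⟩
    have no : ∀ x ∈ Set.Icc a b, D x ≠ 0 := fun x hx h0 => by
      have := hD x hx
      rw [h0] at this; norm_num at this
    rcases abs_cases (D a) with ⟨e1, g1⟩ | ⟨e1, g1⟩ <;>
      rcases abs_cases (D b) with ⟨e2, g2⟩ | ⟨e2, g2⟩ <;> rw [e1] at h1 <;> rw [e2] at h2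
    · exact Or.inl ⟨h1, h2⟩
    · obtain ⟨x, hx, hx0⟩ := intermediate_value_Icc' hab.le h.continuous.continuousOn ⟨g2.le, g1⟩
      exact absurd hx0 (no x hx)
    · obtain ⟨x, hx, hx0⟩ := intermediate_value_Icc hab.le h.continuous.continuousOn ⟨g1.le, g2⟩
      exact absurd hx0 (no x hx)
    · exact Or.inr ⟨by linarith, by linarith⟩
  have hopp : (oscCos D M a < 0 ∧ 0 < oscCos D M b) ∨
      (0 < oscCos D M a ∧ oscCos D M b < 0) := by
    rw [ea, eb]
    rcases neg_one_pow_eq_or ℝ k with e | e <;> rw [e] <;> rcases hsign with ⟨h1, h2⟩ | ⟨h1, h2⟩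
    · exact Or.inr ⟨by linarith, by linarith⟩
    · exact Or.inl ⟨by linarith, by linarith⟩
    · exact Or.inl ⟨by linarith, by linarith⟩
    · exact Or.inr ⟨by linarith, by linarith⟩
  rcases hopp with ⟨h1, h2⟩ | ⟨h1, h2⟩
  · exact intermediate_value_Ioo hab.le cont ⟨h1, h2⟩
  · exact intermediate_value_Ioo' hab.le cont ⟨h2, h1⟩

end IsBoundedAmplitude

/-! ### Counting half-periods -/

/-- The `k`-th half-period `[kπ/M, (k+1)π/M]` of `u ↦ cos (M u)`, as a closed interval; consecutive
half-periods share an end point. -/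
def halfPeriod (M k : ℕ) : Set ℝ := Set.Icc (k * Real.pi / M) ((k + 1) * Real.pi / M)

open Classical in
/-- The indices `k < M` of the half-periods in `[0, π]` that meet `K`. -/
noncomputable def meetingIndices (K : Set ℝ) (M : ℕ) : Finset ℕ :=
  (Finset.range M).filter fun k => (halfPeriod M k ∩ K).Nonempty

theorem mem_meetingIndices {K : Set ℝ} {M k : ℕ} :
    k ∈ meetingIndices K M ↔ k < M ∧ ∃ u ∈ halfPeriod M k, u ∈ K := by
  classical
  simp only [meetingIndices, Finset.mem_filter, Finset.mem_range]
  rfl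

theorem halfPeriod_subset {M k : ℕ} (hk : k < M) : halfPeriod M k ⊆ Set.Icc 0 Real.pi := by
  intro u hu
  have hM : (0 : ℝ) < M := by exact_mod_cast (Nat.zero_le k).trans_lt hk
  have hk' : (k : ℝ) + 1 ≤ M := by exact_mod_cast hk
  have := Real.pi_pos
  refine ⟨le_trans (by positivity) hu.1, hu.2.trans ?_⟩
  rw [div_le_iff₀ hM]
  nlinarith

/-- A point of `[0, π)` lies in the half-period whose index is `⌊M u / π⌋`. -/
theorem mem_halfPeriod_floor {M : ℕ} (hM : 0 < M) {u : ℝ} (hu : u ∈ Set.Ico 0 Real.pi) :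
    ⌊M * u / Real.pi⌋₊ < M ∧ u ∈ halfPeriod M ⌊M * u / Real.pi⌋₊ := by
  have hM' : (0 : ℝ) < M := by exact_mod_cast hM
  have hpi := Real.pi_pos
  have h0 : 0 ≤ M * u / Real.pi := by have := hu.1; positivity
  refine ⟨?_, ?_, ?_⟩
  · rw [Nat.floor_lt h0, div_lt_iff₀ hpi]
    exact mul_lt_mul_of_pos_left hu.2 hM'
  · have := Nat.floor_le h0
    rw [le_div_iff₀ hpi] at this
    rw [div_le_iff₀ hM']; linarith
  · have := Nat.lt_floor_add_one (M * u / Real.pi)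
    rw [div_lt_iff₀ hpi] at this
    rw [le_div_iff₀ hM']; linarith

theorem floor_eq_of_mem_Ioo {M k : ℕ} (hM : 0 < M) {u : ℝ}
    (hu : u ∈ Set.Ioo (k * Real.pi / M) ((k + 1) * Real.pi / M)) :
    ⌊M * u / Real.pi⌋₊ = k := by
  have hM' : (0 : ℝ) < M := by exact_mod_cast hM
  have hpi := Real.pi_pos
  have h1 := hu.1
  have h2 := hu.2
  rw [div_lt_iff₀ hM'] at h1
  rw [lt_div_iff₀ hM'] at h2
  have h0 : 0 ≤ M * u / Real.pi := by
    rw [le_div_iff₀ hpi, zero_mul]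
    nlinarith [Nat.cast_nonneg (α := ℝ) k]
  rw [Nat.floor_eq_iff h0, le_div_iff₀ hpi, div_lt_iff₀ hpi]
  exact ⟨by linarith, by linarith⟩

/-- The half-periods that meet a compact set `K` have total length at most `|K| + ε` once they
are short, because they lie in a small thickening of `K`. -/
theorem eventually_card_meetingIndices_le {K : Set ℝ} (hK : IsCompact K) {ε : ℝ} (hε : 0 < ε) :
    ∀ᶠ M : ℕ in Filter.atTop, (meetingIndices K M).card * (Real.pi / M) ≤
      MeasureTheory.volume.real K + ε := by
  have hr : Filter.Tendsto (fun M : ℕ => Real.pi / M) Filter.atTop (nhds 0) :=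
    tendsto_const_div_atTop_nhds_zero_nat _
  have ht := (tendsto_measure_cthickening_of_isCompact (μ := MeasureTheory.volume) hK).comp hr
  have hfin : MeasureTheory.volume K ≠ ⊤ := hK.measure_lt_top.ne
  have hlt : MeasureTheory.volume K < MeasureTheory.volume K + ENNReal.ofReal ε :=
    ENNReal.lt_add_right hfin (by simpa using hε)
  filter_upwards [ht.eventually_lt_const hlt, Filter.eventually_gt_atTop 0] with M hM hM0
  have hM' : (0 : ℝ) < M := by exact_mod_cast hM0
  have hpi := Real.pi_pos
  have hsub : (⋃ k ∈ meetingIndices K M,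
      Set.Ico (k * Real.pi / M) ((k + 1) * Real.pi / M)) ⊆ Metric.cthickening (Real.pi / M) K := by
    intro u hu
    simp only [Set.mem_iUnion] at hu
    obtain ⟨k, hk, hu⟩ := hu
    obtain ⟨-, v, hv, hvK⟩ := mem_meetingIndices.1 hk
    refine Metric.mem_cthickening_of_dist_le u v _ _ hvK ?_
    have e : (k + 1) * Real.pi / M = k * Real.pi / M + Real.pi / M := by ring
    rw [halfPeriod, e] at hv
    rw [e] at hu
    rw [Real.dist_eq, abs_le]
    constructor <;> linarith [hv.1, hv.2, hu.1, hu.2]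
  have hdisj : Set.PairwiseDisjoint (↑(meetingIndices K M) : Set ℕ) fun k : ℕ =>
      Set.Ico (k * Real.pi / M) ((k + 1) * Real.pi / M) := by
    intro i _ j _ hij
    have hmono : Monotone fun k : ℕ => (k : ℝ) * Real.pi / M := by
      intro a b hab
      have : (a : ℝ) ≤ b := by exact_mod_cast hab
      dsimp only; gcongr
    have := hmono.pairwise_disjoint_on_Ico_succ hij
    simpa [Function.onFun] using this
  have hvol : MeasureTheory.volume (⋃ k ∈ meetingIndices K M,
      Set.Ico (k * Real.pi / M) ((k + 1) * Real.pi / M)) =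
      ENNReal.ofReal ((meetingIndices K M).card * (Real.pi / M)) := by
    rw [MeasureTheory.measure_biUnion_finset hdisj fun _ _ => measurableSet_Ico]
    have e : ∀ k : ℕ, (k + 1) * Real.pi / M - k * Real.pi / M = Real.pi / M := fun k => by ring
    simp only [Real.volume_Ico, e, Finset.sum_const, nsmul_eq_mul]
    rw [ENNReal.ofReal_mul (by positivity), ENNReal.ofReal_natCast]
  have h1 := (MeasureTheory.measure_mono hsub).trans hM.le
  rw [hvol, ENNReal.ofReal_le_iff_le_toReal (by finiteness),
    ENNReal.toReal_add hfin (by finiteness), ENNReal.toReal_ofReal hε.le] at h1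
  exact h1

namespace IsBoundedAmplitude

variable {D D₁ D₂ : ℝ → ℝ} {C : ℝ}

/-- Each half-period on which the amplitude exceeds `1 / 2` contributes a zero. -/
theorem exists_finset_zeros (h : IsBoundedAmplitude D D₁ D₂ C) {M : ℕ} (hM : 0 < M) :
    ∃ S : Finset ℝ, (∀ u ∈ S, u ∈ Set.Ico 0 Real.pi ∧ oscCos D M u = 0) ∧
      M ≤ S.card + (meetingIndices {u ∈ Set.Icc 0 Real.pi | 2 * |D u| ≤ 1} M).card := by
  classical
  set V := {u ∈ Set.Icc 0 Real.pi | 2 * |D u| ≤ 1}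
  have hM' : (0 : ℝ) < M := by exact_mod_cast hM
  have hex : ∀ k ∈ Finset.range M \ meetingIndices V M,
      ∃ u ∈ Set.Ioo (k * Real.pi / M) ((k + 1) * Real.pi / M), oscCos D M u = 0 := by
    intro k hk
    rw [Finset.mem_sdiff, Finset.mem_range, mem_meetingIndices] at hk
    refine h.exists_zero hM' k fun u hu => ?_
    by_contra hle
    exact hk.2 ⟨hk.1, u, hu, halfPeriod_subset hk.1 hu, not_lt.1 hle⟩
  choose! f hf hf0 using hex
  refine ⟨(Finset.range M \ meetingIndices V M).image f, ?_, ?_⟩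
  · intro u hu
    obtain ⟨k, hk, rfl⟩ := Finset.mem_image.1 hu
    refine ⟨⟨?_, ?_⟩, hf0 k hk⟩
    · exact (halfPeriod_subset (Finset.mem_range.1 (Finset.mem_sdiff.1 hk).1)
        (Set.Ioo_subset_Icc_self (hf k hk))).1
    · refine (hf k hk).2.trans_le ?_
      have := (halfPeriod_subset (Finset.mem_range.1 (Finset.mem_sdiff.1 hk).1)
        (Set.right_mem_Icc.2 ((hf k hk).1.trans (hf k hk).2).le)).2
      exact this
  · rw [Finset.card_image_of_injOn]
    · have := Finset.le_card_sdiff (meetingIndices V M) (Finset.range M)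
      rw [Finset.card_range] at this
      omega
    · intro i hi j hj hij
      rw [← floor_eq_of_mem_Ioo hM (hf i hi), ← floor_eq_of_mem_Ioo hM (hf j hj), hij]

/-- A half-period contains a bounded number of zeros: cut it into boundedly many pieces with at
most two zeros each. -/
theorem card_zeros_halfPeriod_le (h : IsBoundedAmplitude D D₁ D₂ C) {M k : ℕ} (hM1 : 0 < M)
    (hM : 20 * C ≤ M) (S : Finset ℝ) (hS : ∀ u ∈ S, u ∈ halfPeriod M k ∧ oscCos D M u = 0) :
    S.card ≤ 2 * (⌊8 * C * Real.pi⌋₊ + 1) := by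
  by_contra! hlt
  have hM' : (1 : ℝ) ≤ M := by exact_mod_cast hM1
  have hC := h.nonneg
  have hCM : 0 ≤ 8 * C * M := by positivity
  set a := k * Real.pi / M with ha
  have hnn : ∀ u ∈ S, 0 ≤ 8 * C * M * (u - a) := fun u hu =>
    mul_nonneg hCM (sub_nonneg.2 (hS u hu).1.1)
  have hmaps : ∀ u ∈ S, ⌊8 * C * M * (u - a)⌋₊ ∈ Finset.range (⌊8 * C * Real.pi⌋₊ + 1) := by
    intro u hu
    rw [Finset.mem_range, Nat.lt_add_one_iff]
    refine Nat.floor_mono ?_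
    have : M * (u - a) ≤ Real.pi := by
      have h2 := (hS u hu).1.2
      rw [le_div_iff₀ (by linarith)] at h2
      have : M * a = k * Real.pi := by rw [ha]; field_simp
      linarith
    nlinarith
  obtain ⟨j, -, hj⟩ := Finset.exists_lt_card_fiber_of_mul_lt_card_of_maps_to hmaps
    (n := 2) (by rw [Finset.card_range]; omega)
  set T := S.filter fun u => ⌊8 * C * M * (u - a)⌋₊ = j
  have hT : T.Nonempty := Finset.card_pos.1 (by omega)
  obtain ⟨b, hb⟩ : ((T.erase (T.min' hT)).erase (T.max' hT)).Nonempty := by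
    refine Finset.card_pos.1 ?_
    have h1 := Finset.pred_card_le_card_erase (s := T) (a := T.min' hT)
    have h2 := Finset.pred_card_le_card_erase (s := T.erase (T.min' hT)) (a := T.max' hT)
    omega
  rw [Finset.mem_erase, Finset.mem_erase] at hb
  have hmin := Finset.mem_filter.1 (T.min'_mem hT)
  have hmax := Finset.mem_filter.1 (T.max'_mem hT)
  refine h.not_three_zeros hM' hM (lt_of_le_of_ne (T.min'_le b hb.2.2) (Ne.symm hb.2.1))
    (lt_of_le_of_ne (T.le_max' b hb.2.2) hb.1) ?_ (hS _ hmin.1).2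
    (hS b (Finset.mem_filter.1 hb.2.2).1).2 (hS _ hmax.1).2
  have h1 := Nat.floor_le (hnn _ hmin.1)
  have h2 := Nat.lt_floor_add_one (8 * C * M * (T.max' hT - a))
  rw [hmin.2] at h1
  rw [hmax.2] at h2
  linarith

/-- The sum of the multiplicities `μ u` of finitely many zeros `u` of the oscillation in `[0, π)`:
a half-period contributes nothing when the amplitude stays below `1 / 2`, at most one when it
stays above `(1 + δ) / 2`, and a bounded quantity in general. -/
theorem sum_multiplicities_le (h : IsBoundedAmplitude D D₁ D₂ C) {δ : ℝ} (hδ : 0 < δ) {M : ℕ}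
    (hM1 : 0 < M) (hM : 20 * C ≤ M) (hCM : 2 * C < M * √(1 - ((1 + δ)⁻¹) ^ 2)) (S : Finset ℝ)
    (μ : ℝ → ℕ) (hS : ∀ u ∈ S, u ∈ Set.Ico 0 Real.pi ∧ oscCos D M u = 0)
    (hμ₁ : ∀ u ∈ S, 2 ≤ μ u → oscCos₁ D D₁ M u = 0)
    (hμ₂ : ∀ u ∈ S, 3 ≤ μ u → oscCos₂ D D₁ D₂ M u = 0) :
    ∑ u ∈ S, μ u ≤ (meetingIndices {u ∈ Set.Icc 0 Real.pi | 1 ≤ 2 * |D u|} M).card +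
      4 * (⌊8 * C * Real.pi⌋₊ + 1) *
        (meetingIndices {u ∈ Set.Icc 0 Real.pi | 1 ≤ 2 * |D u| ∧ 2 * |D u| ≤ 1 + δ} M).card := by
  classical
  set U := {u ∈ Set.Icc 0 Real.pi | 1 ≤ 2 * |D u|}
  set W := {u ∈ Set.Icc 0 Real.pi | 1 ≤ 2 * |D u| ∧ 2 * |D u| ≤ 1 + δ}
  set q := ⌊8 * C * Real.pi⌋₊ + 1
  have hM' : (1 : ℝ) ≤ M := by exact_mod_cast hM1
  have hamp : ∀ u ∈ S, 1 ≤ 2 * |D u| := by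
    intro u hu
    have h1 := abs_cos_mul_eq_half (hS u hu).2
    rw [abs_mul] at h1
    nlinarith [mul_le_of_le_one_left (abs_nonneg (D u)) (Real.abs_cos_le_one (M * u))]
  have hfib : ∀ k ∈ Finset.range M,
      ∑ u ∈ S.filter (fun u => ⌊M * u / Real.pi⌋₊ = k), μ u ≤
        (if k ∈ meetingIndices U M then 1 else 0) +
          4 * q * (if k ∈ meetingIndices W M then 1 else 0) := by
    intro k hk
    set T := S.filter (fun u => ⌊M * u / Real.pi⌋₊ = k)
    have hT : ∀ u ∈ T, u ∈ S ∧ u ∈ halfPeriod M k := by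
      intro u hu
      obtain ⟨hu1, rfl⟩ := Finset.mem_filter.1 hu
      exact ⟨hu1, (mem_halfPeriod_floor hM1 (hS u hu1).1).2⟩
    rcases T.eq_empty_or_nonempty with hemp | ⟨v, hv⟩
    · rw [hemp, Finset.sum_empty]; exact Nat.zero_le _
    have hkU : k ∈ meetingIndices U M :=
      mem_meetingIndices.2 ⟨Finset.mem_range.1 hk, v, (hT v hv).2,
        halfPeriod_subset (Finset.mem_range.1 hk) (hT v hv).2, hamp v (hT v hv).1⟩
    rw [if_pos hkU]
    by_cases hkW : k ∈ meetingIndices W M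
    · rw [if_pos hkW, mul_one]
      have h2 : ∀ u ∈ T, μ u ≤ 2 := by
        intro u hu
        by_contra! hlt
        exact h.oscCos₂_ne_zero_of_zero hM' hM (hS u (hT u hu).1).2 (hμ₂ u (hT u hu).1 hlt)
      have h3 := Finset.sum_le_card_nsmul T μ 2 h2
      have h4 := h.card_zeros_halfPeriod_le hM1 hM T fun u hu =>
        ⟨(hT u hu).2, (hS u (hT u hu).1).2⟩
      rw [smul_eq_mul] at h3
      calc ∑ u ∈ T, μ u ≤ T.card * 2 := h3
        _ ≤ (2 * q) * 2 := Nat.mul_le_mul_right 2 h4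
        _ ≤ 1 + 4 * q := by omega
    · rw [if_neg hkW, mul_zero, add_zero]
      -- by the intermediate value theorem the amplitude is large on the whole half-period
      have hbig : ∀ u ∈ halfPeriod M k, 1 + δ ≤ 2 * |D u| := by
        intro u hu
        by_contra! hlt
        have hnot : ∀ w ∈ halfPeriod M k, ¬ (1 ≤ 2 * |D w| ∧ 2 * |D w| ≤ 1 + δ) :=
          fun w hw hw' => hkW (mem_meetingIndices.2 ⟨Finset.mem_range.1 hk, w, hw,
            halfPeriod_subset (Finset.mem_range.1 hk) hw, hw'⟩)
        have hcont : ContinuousOn (fun w => 2 * |D w|) (halfPeriod M k) :=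
          (continuous_const.mul h.continuous.abs).continuousOn
        have hu1 : 2 * |D u| ≤ 1 := by
          by_contra! h1
          exact hnot u hu ⟨h1.le, hlt.le⟩
        obtain ⟨w, hw, hw1⟩ := isPreconnected_Icc.intermediate_value hu (hT v hv).2 hcont
          ⟨hu1, hamp v (hT v hv).1⟩
        simp only at hw1
        exact hnot w hw ⟨hw1.ge, by linarith⟩
      have hT1 : T = {v} := by
        refine Finset.eq_singleton_iff_unique_mem.2 ⟨hv, fun u hu => ?_⟩
        have order : ∀ x ∈ T, ∀ y ∈ T, ¬ x < y := by
          intro x hx y hy hxy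
          have h1 := (hT x hx).2
          have h2 := (hT y hy).2
          refine h.not_two_zeros hδ (by linarith) hCM k hxy ?_ ?_ (hS x (hT x hx).1).2
            (hS y (hT y hy).1).2 fun w hw => hbig w ⟨h1.1.trans hw.1, hw.2.trans h2.2⟩
          · have := h1.1
            rw [div_le_iff₀ (by linarith)] at this; linarith
          · have := h2.2
            rw [le_div_iff₀ (by linarith)] at this; linarith
        exact le_antisymm (not_lt.1 (order v hv u hu)) (not_lt.1 (order u hu v hv))
      rw [hT1, Finset.sum_singleton]
      by_contra! hlt
      exact h.oscCos₁_ne_zero hδ (by linarith) hCM (hS v (hT v hv).1).2 (hbig v (hT v hv).2)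
        (hμ₁ v (hT v hv).1 hlt)
  have hmaps : ∀ u ∈ S, ⌊M * u / Real.pi⌋₊ ∈ Finset.range M := fun u hu =>
    Finset.mem_range.2 (mem_halfPeriod_floor hM1 (hS u hu).1).1
  rw [← Finset.sum_fiberwise_of_maps_to hmaps]
  refine (Finset.sum_le_sum hfib).trans ?_
  have hsub : ∀ K : Set ℝ, Finset.range M ∩ meetingIndices K M = meetingIndices K M := fun K =>
    Finset.inter_eq_right.2 fun k hk => Finset.mem_range.2 (mem_meetingIndices.1 hk).1
  rw [Finset.sum_add_distrib, ← Finset.mul_sum, Finset.sum_ite_mem, Finset.sum_ite_mem, hsub, hsub]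
  simp

end IsBoundedAmplitude

/-! ### The amplitude of `H` on the unit circle -/

/-- The amplitude `sin ((l + 1) u) / sin u`, written as a trigonometric polynomial. -/
noncomputable def dirichletAmplitude (l : ℕ) (u : ℝ) : ℝ :=
  ∑ j ∈ Finset.range (l + 1), Real.cos (((l : ℝ) - 2 * j) * u)

theorem dirichletAmplitude_mul_sin (l : ℕ) (u : ℝ) :
    dirichletAmplitude l u * Real.sin u = Real.sin ((l + 1) * u) := by
  have h : ∀ j ∈ Finset.range (l + 1), 2 * (Real.cos (((l : ℝ) - 2 * j) * u) * Real.sin u) =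
      Real.sin (((l : ℝ) + 1 - 2 * (j : ℕ)) * u) -
        Real.sin (((l : ℝ) + 1 - 2 * ((j + 1 : ℕ) : ℝ)) * u) := by
    intro j _
    rw [show ((l : ℝ) + 1 - 2 * (j : ℕ)) * u = ((l : ℝ) - 2 * j) * u + u by ring,
      show ((l : ℝ) + 1 - 2 * ((j + 1 : ℕ) : ℝ)) * u = ((l : ℝ) - 2 * j) * u - u by push_cast; ring,
      Real.sin_add, Real.sin_sub]
    ring
  have h2 := Finset.sum_congr rfl h
  rw [Finset.sum_range_sub' (fun j : ℕ => Real.sin (((l : ℝ) + 1 - 2 * (j : ℕ)) * u)),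
    ← Finset.mul_sum, ← Finset.sum_mul] at h2
  rw [show ((l : ℝ) + 1 - 2 * ((l + 1 : ℕ) : ℝ)) * u = -((l + 1) * u) by push_cast; ring,
    Real.sin_neg] at h2
  simp only [Nat.cast_zero, mul_zero, sub_zero] at h2
  rw [dirichletAmplitude]
  linarith

theorem dirichletAmplitude_zero (l : ℕ) : dirichletAmplitude l 0 = l + 1 := by
  simp [dirichletAmplitude]

theorem isBoundedAmplitude_dirichletAmplitude (l : ℕ) :
    IsBoundedAmplitude (dirichletAmplitude l)
      (fun u => ∑ j ∈ Finset.range (l + 1),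
        -(((l : ℝ) - 2 * j) * Real.sin (((l : ℝ) - 2 * j) * u)))
      (fun u => ∑ j ∈ Finset.range (l + 1),
        -(((l : ℝ) - 2 * j) ^ 2 * Real.cos (((l : ℝ) - 2 * j) * u)))
      (((l + 1 : ℕ) : ℝ) * ((l : ℝ) + 1) ^ 2) := by
  have hlin : ∀ c u : ℝ, HasDerivAt (fun u : ℝ => c * u) c u := fun c u => by
    simpa using (hasDerivAt_id u).const_mul c
  have hfreq : ∀ j ∈ Finset.range (l + 1), |(l : ℝ) - 2 * j| ≤ l + 1 := by
    intro j hj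
    have : (j : ℝ) ≤ l := by exact_mod_cast Nat.lt_add_one_iff.1 (Finset.mem_range.1 hj)
    have h0 : (0 : ℝ) ≤ j := Nat.cast_nonneg j
    rw [abs_le]; constructor <;> linarith
  have hl : (1 : ℝ) ≤ l + 1 := by have := Nat.cast_nonneg (α := ℝ) l; linarith
  have hsum : ∀ f : ℕ → ℝ, (∀ j ∈ Finset.range (l + 1), |f j| ≤ ((l : ℝ) + 1) ^ 2) →
      |∑ j ∈ Finset.range (l + 1), f j| ≤ ((l + 1 : ℕ) : ℝ) * ((l : ℝ) + 1) ^ 2 := by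
    intro f hf
    refine (Finset.abs_sum_le_sum_abs _ _).trans ((Finset.sum_le_card_nsmul _ _ _ hf).trans ?_)
    rw [Finset.card_range, nsmul_eq_mul]
  refine ⟨fun u => ?_, fun u => ?_, fun u => hsum _ fun j hj => ?_, fun u => hsum _ fun j hj => ?_,
    fun u => hsum _ fun j hj => ?_⟩
  · refine HasDerivAt.fun_sum fun j _ => ((hlin _ u).cos).congr_deriv ?_
    ring
  · refine HasDerivAt.fun_sum fun j _ => (((hlin _ u).sin.const_mul _).neg).congr_deriv ?_
    ring
  · have := Real.abs_cos_le_one (((l : ℝ) - 2 * j) * u)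
    nlinarith
  · rw [abs_neg, abs_mul]
    have h1 := Real.abs_sin_le_one (((l : ℝ) - 2 * j) * u)
    have h2 := hfreq j hj
    calc _ ≤ ((l : ℝ) + 1) * 1 := by gcongr
      _ ≤ _ := by nlinarith
  · rw [abs_neg, abs_mul, abs_pow]
    have h1 := Real.abs_cos_le_one (((l : ℝ) - 2 * j) * u)
    have h2 := hfreq j hj
    calc _ ≤ ((l : ℝ) + 1) ^ 2 * 1 := by gcongr
      _ = _ := mul_one _

/-- Pairing the terms `j` and `l - j` turns the sum of cosines into a product. -/
theorem sum_two_cos_eq (l n : ℕ) (u : ℝ) :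
    ∑ j ∈ Finset.range (l + 1), 2 * Real.cos (2 * (n + j) * u) =
      2 * Real.cos (((2 * n + l : ℕ) : ℝ) * u) * dirichletAmplitude l u := by
  have h : ∀ j ∈ Finset.range (l + 1),
      2 * Real.cos (((2 * n + l : ℕ) : ℝ) * u) * Real.cos (((l : ℝ) - 2 * j) * u) =
        Real.cos (2 * (n + ((l + 1 - 1 - j : ℕ) : ℝ)) * u) + Real.cos (2 * (n + j) * u) := by
    intro j hj
    have hj' : j ≤ l := Nat.lt_add_one_iff.1 (Finset.mem_range.1 hj)
    rw [Nat.add_sub_cancel, Nat.cast_sub hj',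
      show 2 * ((n : ℝ) + (l - j)) * u =
        ((2 * n + l : ℕ) : ℝ) * u + ((l : ℝ) - 2 * j) * u by push_cast; ring,
      show 2 * ((n : ℝ) + j) * u =
        ((2 * n + l : ℕ) : ℝ) * u - ((l : ℝ) - 2 * j) * u by push_cast; ring,
      Real.cos_add, Real.cos_sub]
    ring
  rw [dirichletAmplitude, Finset.mul_sum, Finset.sum_congr rfl h, Finset.sum_add_distrib,
    Finset.sum_range_reflect (fun j : ℕ => Real.cos (2 * ((n : ℝ) + j) * u)), ← Finset.mul_sum]
  ring

/-- On the unit circle, `H` is a unimodular factor times a real oscillation. -/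
theorem aeval_polyH_exp (l n : ℕ) (u : ℝ) :
    aeval (Complex.exp (2 * Complex.I * u)) (polyH l n) =
      Complex.exp (2 * Complex.I * ((n + l : ℕ) : ℂ) * u) *
        (oscCos (dirichletAmplitude l) ((2 * n + l : ℕ) : ℝ) u : ℂ) := by
  rw [aeval_polyH l n (Complex.exp_ne_zero _), ← Complex.exp_nat_mul, oscCos, ← sum_two_cos_eq]
  push_cast
  congr 1
  · congr 1; ring
  · congr 1
    refine Finset.sum_congr rfl fun j _ => ?_
    rw [← Complex.exp_nat_mul, one_div, ← Complex.exp_neg, Complex.two_cos]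
    push_cast
    congr 2 <;> ring

theorem natDegree_polyH {l n : ℕ} (h : 0 < n + l) : (polyH l n).natDegree = 2 * n + 2 * l := by
  have e : polyH l n = X ^ (2 * n + 2 * l) + (∑ j ∈ Finset.range l,
      (X ^ ((n + l) + (n + j)) + X ^ ((n + l) - (n + j))) + 1 + X ^ (n + l)) := by
    rw [polyH, Finset.sum_range_succ, Nat.sub_self, pow_zero,
      show n + l + (n + l) = 2 * n + 2 * l by ring]
    ring
  rw [e, natDegree_add_eq_left_of_natDegree_lt, natDegree_X_pow]
  rw [natDegree_X_pow]
  refine Nat.lt_of_le_of_lt (m := 2 * n + 2 * l - 1) ?_ (by omega)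
  refine natDegree_add_le_of_degree_le (natDegree_add_le_of_degree_le
    (natDegree_sum_le_of_forall_le _ _ fun j hj => ?_) ?_) ?_
  · have := Finset.mem_range.1 hj
    refine natDegree_add_le_of_degree_le ?_ ?_ <;> rw [natDegree_X_pow] <;> omega
  · rw [natDegree_one]; omega
  · rw [natDegree_X_pow]; omega

theorem polyH_ne_zero {l n : ℕ} (h : 0 < n + l) : polyH l n ≠ 0 := by
  intro h0
  have := natDegree_polyH h
  rw [h0, natDegree_zero] at this
  omega

/-! ### Unimodular zeros -/

/-- The number of unimodular zeros of `P`, counted with multiplicity. -/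
noncomputable def numZerosCircle (P : ℤ[X]) : ℕ :=
  (P.aroots ℂ).countP (fun z => ‖z‖ = 1)

theorem numZeros_add (P : ℤ[X]) :
    numZerosInside P + numZerosOutside P + numZerosCircle P = P.natDegree := by
  have hcard : Multiset.card (P.aroots ℂ) = P.natDegree :=
    IsAlgClosed.card_aroots_eq_natDegree
  rw [← hcard, numZerosInside, numZerosOutside, numZerosCircle]
  induction P.aroots ℂ using Multiset.induction_on with
  | empty => simp
  | cons a s ih =>
    rw [Multiset.card_cons, Multiset.countP_cons, Multiset.countP_cons, Multiset.countP_cons]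
    rcases lt_trichotomy ‖a‖ 1 with h | h | h
    · rw [if_pos h, if_neg h.not_gt, if_neg h.ne]; omega
    · rw [if_neg h.not_lt, if_neg h.not_gt, if_pos h]; omega
    · rw [if_neg h.not_gt, if_pos h, if_neg h.ne']; omega

/-- If `p (e^{2iu}) = e^{cu} f(u)` on the real line, then multiplicities of zeros of `p` on the
unit circle show in the derivatives of `f`. -/
theorem derivatives_eq_zero_of_rootMultiplicity {p : ℂ[X]} (hp : p ≠ 0) {c : ℂ} {f f₁ f₂ : ℝ → ℝ}
    (hf : ∀ u, HasDerivAt f (f₁ u) u) (hf₁ : ∀ u, HasDerivAt f₁ (f₂ u) u)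
    (h : ∀ u : ℝ, p.eval (Complex.exp (2 * Complex.I * u)) = Complex.exp (c * u) * f u) (u : ℝ) :
    (2 ≤ p.rootMultiplicity (Complex.exp (2 * Complex.I * u)) → f₁ u = 0) ∧
    (3 ≤ p.rootMultiplicity (Complex.exp (2 * Complex.I * u)) → f₂ u = 0) := by
  have hexp : ∀ (c : ℂ) (u : ℝ), HasDerivAt (fun u : ℝ => Complex.exp (c * u))
      (Complex.exp (c * u) * c) u := by
    intro c u
    have : HasDerivAt (fun u : ℝ => c * (u : ℂ)) c u := by
      simpa using (Complex.ofRealCLM.hasDerivAt (x := u)).const_mul c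
    exact this.cexp
  have hcomp : ∀ (q : ℂ[X]) (u : ℝ), HasDerivAt
      (fun u : ℝ => q.eval (Complex.exp (2 * Complex.I * u)))
      (q.derivative.eval (Complex.exp (2 * Complex.I * u)) *
        (Complex.exp (2 * Complex.I * u) * (2 * Complex.I))) u := fun q u =>
    HasDerivAt.comp (h₂ := fun z => q.eval z) u (q.hasDerivAt _) (hexp (2 * Complex.I) u)
  have h₁ : ∀ u : ℝ, p.derivative.eval (Complex.exp (2 * Complex.I * u)) *
        (Complex.exp (2 * Complex.I * u) * (2 * Complex.I)) =
      Complex.exp (c * u) * c * f u + Complex.exp (c * u) * f₁ u := fun u =>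
    (hcomp p u).unique (((hexp c u).mul (hf u).ofReal_comp).congr_of_eventuallyEq
      (Filter.Eventually.of_forall h))
  have h₂ :=
    ((hcomp p.derivative u).mul ((hexp (2 * Complex.I) u).mul_const (2 * Complex.I))).unique
    (((((hexp c u).mul_const c).mul (hf u).ofReal_comp).add
      ((hexp c u).mul (hf₁ u).ofReal_comp)).congr_of_eventuallyEq
      (Filter.Eventually.of_forall h₁))
  have hc : Complex.exp (c * u) ≠ 0 := Complex.exp_ne_zero _
  have key₁ : 2 ≤ p.rootMultiplicity (Complex.exp (2 * Complex.I * u)) → f u = 0 ∧ f₁ u = 0 := by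
    intro hm
    have hd := (one_lt_rootMultiplicity_iff_isRoot hp).1 hm
    have h0 := h u
    have h1 := h₁ u
    rw [hd.1.eq_zero] at h0
    rw [hd.2.eq_zero, zero_mul] at h1
    have hf0 : (f u : ℂ) = 0 := by simpa [hc] using h0.symm
    rw [hf0, mul_zero, zero_add] at h1
    refine ⟨by exact_mod_cast hf0, ?_⟩
    have : (f₁ u : ℂ) = 0 := by simpa [hc] using h1.symm
    exact_mod_cast this
  refine ⟨fun hm => (key₁ hm).2, fun hm => ?_⟩
  obtain ⟨hf0, hf10⟩ := key₁ (by omega)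
  have hd := (lt_rootMultiplicity_iff_isRoot_iterate_derivative hp (n := 2)).1 hm
  have hd1 := hd 1 (by norm_num)
  have hd2 := hd 2 le_rfl
  simp only [Function.iterate_succ, Function.iterate_zero, Function.comp, id] at hd1 hd2
  rw [hd1.eq_zero, hd2.eq_zero, hf0, hf10] at h₂
  have : (f₂ u : ℂ) = 0 := by simpa [hc] using h₂.symm
  exact_mod_cast this

/-- The unit circle is traversed once by `e^{2iu}` with `u` in `[0, π)`. -/
theorem exists_exp_eq_of_norm_eq_one {z : ℂ} (hz : ‖z‖ = 1) :
    ∃ u ∈ Set.Ico 0 Real.pi, Complex.exp (2 * Complex.I * (u : ℝ)) = z := by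
  have hz' : Complex.exp (z.arg * Complex.I) = z := by
    have := Complex.norm_mul_exp_arg_mul_I z
    rwa [hz, Complex.ofReal_one, one_mul] at this
  have h1 := Complex.neg_pi_lt_arg z
  have h2 := Complex.arg_le_pi z
  have hpi := Real.pi_pos
  rcases le_or_gt 0 z.arg with h | h
  · refine ⟨z.arg / 2, ⟨by linarith, by linarith⟩, ?_⟩
    rw [← hz']
    congr 1
    rw [hz']; push_cast; ring
  · refine ⟨z.arg / 2 + Real.pi, ⟨by linarith, by linarith⟩, ?_⟩
    have e : 2 * Complex.I * ((z.arg / 2 + Real.pi : ℝ) : ℂ) =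
        z.arg * Complex.I + 2 * Real.pi * Complex.I := by push_cast; ring
    rw [e, Complex.exp_add, Complex.exp_two_pi_mul_I, mul_one, hz']

theorem exp_injOn : Set.InjOn (fun u : ℝ => Complex.exp (2 * Complex.I * u))
    (Set.Ico 0 Real.pi) := by
  intro u hu v hv huv
  obtain ⟨k, hk⟩ := Complex.exp_eq_exp_iff_exists_int.1 huv
  have hk' : u = v + k * Real.pi := by
    have h2 : (2 * Complex.I) * (u : ℂ) = (2 * Complex.I) * ((v + k * Real.pi : ℝ) : ℂ) := by
      rw [hk]; push_cast; ring
    exact_mod_cast mul_left_cancel₀ (by simp) h2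
  have hpi := Real.pi_pos
  have h1 : (k : ℝ) < 1 := by
    by_contra! h; nlinarith [hu.2, hv.1]
  have h2 : (-1 : ℝ) < k := by
    by_contra! h; nlinarith [hu.1, hv.2]
  have h3 : k < 1 := by exact_mod_cast h1
  have h4 : -1 < k := by exact_mod_cast h2
  have : k = 0 := by omega
  rw [hk', this]; simp

theorem norm_exp_two_I (u : ℝ) : ‖Complex.exp (2 * Complex.I * u)‖ = 1 := by
  rw [show 2 * Complex.I * (u : ℂ) = ((2 * u : ℝ) : ℂ) * Complex.I by push_cast; ring,
    Complex.norm_exp_ofReal_mul_I]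

theorem mem_aroots_polyH_iff {l n : ℕ} (h : 0 < n + l) (u : ℝ) :
    Complex.exp (2 * Complex.I * u) ∈ (polyH l n).aroots ℂ ↔
      oscCos (dirichletAmplitude l) ((2 * n + l : ℕ) : ℝ) u = 0 := by
  rw [mem_aroots, aeval_polyH_exp]
  simp [polyH_ne_zero h]

/-- All `2n + l` half-periods in `[0, π]` contribute a unimodular zero, except those on which the
amplitude is somewhere at most `1 / 2`. -/
theorem le_numZerosCircle_polyH {l n : ℕ} (hM : 0 < 2 * n + l) :
    2 * n + l ≤ numZerosCircle (polyH l n) +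
      (meetingIndices {u ∈ Set.Icc 0 Real.pi | 2 * |dirichletAmplitude l u| ≤ 1}
        (2 * n + l)).card := by
  classical
  obtain ⟨S, hS, hcard⟩ := (isBoundedAmplitude_dirichletAmplitude l).exists_finset_zeros hM
  refine hcard.trans (Nat.add_le_add_right ?_ _)
  have hinj : Set.InjOn (fun u : ℝ => Complex.exp (2 * Complex.I * u)) S :=
    exp_injOn.mono fun u hu => (hS u hu).1
  rw [← Finset.card_image_of_injOn hinj, numZerosCircle, Multiset.countP_eq_card_filter]
  refine Multiset.card_le_card ((Multiset.le_iff_subset (Finset.nodup _)).2 fun z hz => ?_)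
  obtain ⟨u, hu, rfl⟩ := Finset.mem_image.1 (Finset.mem_def.2 hz)
  exact Multiset.mem_filter.2 ⟨(mem_aroots_polyH_iff (by omega) u).2 (hS u hu).2, norm_exp_two_I u⟩

/-- For large `n`, only half-periods on which the amplitude is somewhere at least `1 / 2` contribute
unimodular zeros, and they contribute one each, apart from a bounded excess `Q` for those that
touch the band where the amplitude is close to `1 / 2`. -/
theorem numZerosCircle_polyH_le (l : ℕ) :
    ∃ Q : ℕ, ∀ δ : ℝ, 0 < δ → ∀ᶠ n : ℕ in Filter.atTop, numZerosCircle (polyH l n) ≤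
      (meetingIndices {u ∈ Set.Icc 0 Real.pi | 1 ≤ 2 * |dirichletAmplitude l u|} (2 * n + l)).card +
      Q * (meetingIndices {u ∈ Set.Icc 0 Real.pi | 1 ≤ 2 * |dirichletAmplitude l u| ∧
        2 * |dirichletAmplitude l u| ≤ 1 + δ} (2 * n + l)).card := by
  classical
  have hD := isBoundedAmplitude_dirichletAmplitude l
  set C : ℝ := ((l + 1 : ℕ) : ℝ) * ((l : ℝ) + 1) ^ 2
  have hM : Filter.Tendsto (fun n : ℕ => ((2 * n + l : ℕ) : ℝ)) Filter.atTop Filter.atTop :=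
    tendsto_natCast_atTop_atTop.comp
      (Filter.tendsto_atTop_mono (fun n => (by omega : n ≤ 2 * n + l)) Filter.tendsto_id)
  refine ⟨4 * (⌊8 * C * Real.pi⌋₊ + 1), fun δ hδ => ?_⟩
  have hs : 0 < √(1 - ((1 + δ)⁻¹) ^ 2) := by
    refine Real.sqrt_pos.2 (sub_pos.2 (pow_lt_one₀ (by positivity) ?_ two_ne_zero))
    exact inv_lt_one_of_one_lt₀ (by linarith)
  filter_upwards [Filter.eventually_gt_atTop 0, hM.eventually_ge_atTop (20 * C),
    (hM.atTop_mul_const hs).eventually_gt_atTop (2 * C)] with n hn h20 h2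
  have hp : polyH l n ≠ 0 := polyH_ne_zero (by omega)
  have hp' : (polyH l n).map (algebraMap ℤ ℂ) ≠ 0 :=
    (Polynomial.map_ne_zero_iff (algebraMap ℤ ℂ).injective_int).2 hp
  set R := ((polyH l n).aroots ℂ).filter fun z => ‖z‖ = 1 with hR
  have hex : ∀ z ∈ R.toFinset, ∃ u ∈ Set.Ico 0 Real.pi,
      Complex.exp (2 * Complex.I * (u : ℝ)) = z := fun z hz =>
    exists_exp_eq_of_norm_eq_one (Multiset.mem_filter.1 (Multiset.mem_toFinset.1 hz)).2
  choose! f hf hfz using hex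
  have hinj : Set.InjOn f R.toFinset := fun z hz w hw hzw => by
    rw [← hfz z hz, ← hfz w hw, hzw]
  set μ : ℝ → ℕ := fun u =>
    ((polyH l n).map (algebraMap ℤ ℂ)).rootMultiplicity (Complex.exp (2 * Complex.I * u))
  have hcount : numZerosCircle (polyH l n) = ∑ u ∈ R.toFinset.image f, μ u := by
    rw [Finset.sum_image hinj, numZerosCircle, Multiset.countP_eq_card_filter, ← hR,
      ← Multiset.toFinset_sum_count_eq]
    refine Finset.sum_congr rfl fun z hz => ?_
    have hz1 := (Multiset.mem_filter.1 (Multiset.mem_toFinset.1 hz)).2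
    dsimp only [μ]
    rw [hR, Multiset.count_filter_of_pos (p := fun z : ℂ => ‖z‖ = 1) hz1, aroots, count_roots,
      hfz z hz]
  have hder := derivatives_eq_zero_of_rootMultiplicity hp'
    (c := 2 * Complex.I * ((n + l : ℕ) : ℂ))
    (hD.hasDerivAt_oscCos ((2 * n + l : ℕ) : ℝ)) (hD.hasDerivAt_oscCos₁ ((2 * n + l : ℕ) : ℝ))
    (fun u => by rw [eval_map_algebraMap, aeval_polyH_exp])
  rw [hcount]
  refine hD.sum_multiplicities_le hδ (by omega) h20 h2 _ μ ?_
    (fun u _ => (hder u).1) (fun u _ => (hder u).2)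
  intro u hu
  obtain ⟨z, hz, rfl⟩ := Finset.mem_image.1 hu
  refine ⟨hf z hz, (mem_aroots_polyH_iff (by omega) _).1 ?_⟩
  rw [hfz z hz]
  exact (Multiset.mem_filter.1 (Multiset.mem_toFinset.1 hz)).1

/-! ### The limit ratio -/

open MeasureTheory

/-- The level set `|D| = 1 / 2` is discrete, since `D` is analytic with `D 0 = l + 1`. -/
theorem volume_level_eq_zero (l : ℕ) :
    volume {u : ℝ | 2 * |dirichletAmplitude l u| = 1} = 0 := by
  have han : AnalyticOnNhd ℝ (fun u => 4 * dirichletAmplitude l u ^ 2 - 1) Set.univ := by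
    intro u _
    unfold dirichletAmplitude
    fun_prop
  have hne : 4 * dirichletAmplitude l 0 ^ 2 - 1 ≠ 0 := by
    rw [dirichletAmplitude_zero]
    have := Nat.cast_nonneg (α := ℝ) l
    nlinarith
  have hcod := han.preimage_zero_mem_codiscreteWithin hne (Set.mem_univ 0) isConnected_univ
  have hae := ae_restrict_le_codiscreteWithin (μ := volume) MeasurableSet.univ hcod
  rw [Measure.restrict_univ, mem_ae_iff] at hae
  refine measure_mono_null (fun u hu => ?_) hae
  simp only [Set.mem_compl_iff, not_not, Set.mem_preimage, Set.mem_singleton_iff]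
  rw [← sq_abs]
  have : 2 * |dirichletAmplitude l u| = 1 := hu
  nlinarith

/-- A closed condition on the size of the amplitude cuts out a compact subset of `[0, π]`. -/
theorem isCompact_amplitude_mem {l : ℕ} {s : Set ℝ} (hs : IsClosed s) :
    IsCompact {u ∈ Set.Icc 0 Real.pi | 2 * |dirichletAmplitude l u| ∈ s} :=
  isCompact_Icc.inter_right (hs.preimage (continuous_const.mul
    (isBoundedAmplitude_dirichletAmplitude l).continuous.abs))

/-- The bands `1 ≤ 2 |D| ≤ 1 + δ` shrink to the level set `2 |D| = 1`, which is null. -/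
theorem exists_volume_band_le (l : ℕ) {ε : ℝ} (hε : 0 < ε) :
    ∃ δ : ℝ, 0 < δ ∧ volume.real {u ∈ Set.Icc 0 Real.pi | 1 ≤ 2 * |dirichletAmplitude l u| ∧
      2 * |dirichletAmplitude l u| ≤ 1 + δ} ≤ ε := by
  set W : ℕ → Set ℝ := fun p => {u ∈ Set.Icc 0 Real.pi |
    2 * |dirichletAmplitude l u| ∈ Set.Icc 1 (1 + 1 / ((p : ℝ) + 1))} with hW
  have hcomp : ∀ p, IsCompact (W p) := fun p => isCompact_amplitude_mem isClosed_Icc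
  have hanti : Antitone W := by
    intro p q hpq u hu
    refine ⟨hu.1, hu.2.1, hu.2.2.trans ?_⟩
    have : 1 / ((q : ℝ) + 1) ≤ 1 / ((p : ℝ) + 1) := Nat.one_div_le_one_div hpq
    linarith
  have hnull : volume (⋂ p, W p) = 0 := by
    refine measure_mono_null (fun u hu => ?_) (volume_level_eq_zero l)
    rw [Set.mem_iInter] at hu
    refine le_antisymm ?_ (hu 0).2.1
    have h1 : Filter.Tendsto (fun p : ℕ => 1 + 1 / ((p : ℝ) + 1)) Filter.atTop (nhds (1 + 0)) :=
      tendsto_const_nhds.add tendsto_one_div_add_atTop_nhds_zero_nat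
    rw [add_zero] at h1
    exact ge_of_tendsto' h1 fun p => (hu p).2.2
  have ht := tendsto_measure_iInter_atTop (μ := volume)
    (fun p => (hcomp p).measurableSet.nullMeasurableSet) hanti ⟨0, (hcomp 0).measure_lt_top.ne⟩
  rw [hnull] at ht
  obtain ⟨p, hp⟩ := (ht.eventually_le_const (show 0 < ENNReal.ofReal ε by simpa using hε)).exists
  exact ⟨1 / ((p : ℝ) + 1), by positivity, ENNReal.toReal_le_of_le_ofReal hε.le hp⟩

theorem volume_add_volume_eq_pi (l : ℕ) :
    volume.real {u ∈ Set.Icc 0 Real.pi | 1 ≤ 2 * |dirichletAmplitude l u|} +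
      volume.real {u ∈ Set.Icc 0 Real.pi | 2 * |dirichletAmplitude l u| ≤ 1} = Real.pi := by
  have hU := isCompact_amplitude_mem (l := l) (isClosed_Ici (a := 1))
  have hV := isCompact_amplitude_mem (l := l) (isClosed_Iic (a := 1))
  have h := measureReal_union_add_inter (μ := volume) (s := {u ∈ Set.Icc 0 Real.pi |
    2 * |dirichletAmplitude l u| ∈ Set.Ici 1}) hV.measurableSet hU.measure_lt_top.ne
    hV.measure_lt_top.ne
  refine h.symm.trans ?_
  have h1 : volume.real ({u ∈ Set.Icc 0 Real.pi | 2 * |dirichletAmplitude l u| ∈ Set.Ici 1} ∩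
      {u ∈ Set.Icc 0 Real.pi | 2 * |dirichletAmplitude l u| ∈ Set.Iic 1}) = 0 := by
    rw [measureReal_def, measure_mono_null (fun u hu => ?_) (volume_level_eq_zero l),
      ENNReal.toReal_zero]
    exact le_antisymm hu.2.2 hu.1.2
  have h2 : {u ∈ Set.Icc 0 Real.pi | 2 * |dirichletAmplitude l u| ∈ Set.Ici 1} ∪
      {u ∈ Set.Icc 0 Real.pi | 2 * |dirichletAmplitude l u| ∈ Set.Iic 1} = Set.Icc 0 Real.pi := by
    ext u
    constructor
    · rintro (hu | hu) <;> exact hu.1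
    · intro hu
      rcases le_total 1 (2 * |dirichletAmplitude l u|) with h | h
      · exact Or.inl ⟨hu, h⟩
      · exact Or.inr ⟨hu, h⟩
  rw [h1, h2, add_zero, Real.volume_real_Icc_of_le Real.pi_pos.le, sub_zero]

/-- The limit density of the unimodular zeros of `H`, scaled by `π`. -/
theorem tendsto_numZerosCircle_polyH (l : ℕ) :
    Filter.Tendsto (fun n => (numZerosCircle (polyH l n) : ℝ) * (Real.pi / ((2 * n + l : ℕ) : ℝ)))
      Filter.atTop (nhds (volume.real
        {u ∈ Set.Icc 0 Real.pi | 1 ≤ 2 * |dirichletAmplitude l u|})) := by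
  have hU : IsCompact {u ∈ Set.Icc 0 Real.pi | 1 ≤ 2 * |dirichletAmplitude l u|} :=
    isCompact_amplitude_mem isClosed_Ici
  have hV : IsCompact {u ∈ Set.Icc 0 Real.pi | 2 * |dirichletAmplitude l u| ≤ 1} :=
    isCompact_amplitude_mem isClosed_Iic
  have hM : Filter.Tendsto (fun n : ℕ => 2 * n + l) Filter.atTop Filter.atTop :=
    Filter.tendsto_atTop_mono (fun n => (by omega : n ≤ 2 * n + l)) Filter.tendsto_id
  have hpi := Real.pi_pos
  have hsum := volume_add_volume_eq_pi l
  obtain ⟨Q, hQ⟩ := numZerosCircle_polyH_le l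
  rw [Metric.tendsto_nhds]
  intro ε hε
  set ε' := ε / (2 * (2 * Q + 1)) with hε'
  have hε'0 : 0 < ε' := by positivity
  have hε'e : ε' + Q * (ε' + ε') = ε / 2 := by rw [hε']; field_simp; ring
  obtain ⟨δ, hδ, hW⟩ := exists_volume_band_le l hε'0
  have hWc : IsCompact {u ∈ Set.Icc 0 Real.pi | 1 ≤ 2 * |dirichletAmplitude l u| ∧
      2 * |dirichletAmplitude l u| ≤ 1 + δ} := isCompact_amplitude_mem isClosed_Icc
  filter_upwards [hQ δ hδ, Filter.eventually_gt_atTop 0,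
    hM.eventually (eventually_card_meetingIndices_le hU hε'0),
    hM.eventually (eventually_card_meetingIndices_le hWc hε'0),
    hM.eventually (eventually_card_meetingIndices_le hV (half_pos hε))] with n h1 hn h2 h3 h4
  have h5 := le_numZerosCircle_polyH (l := l) (n := n) (by omega)
  have hM0 : (0 : ℝ) < ((2 * n + l : ℕ) : ℝ) := by
    have : 0 < 2 * n + l := by omega
    exact_mod_cast this
  have hc : 0 < Real.pi / ((2 * n + l : ℕ) : ℝ) := by positivity
  generalize 2 * n + l = N at *
  have h1' := mul_le_mul_of_nonneg_right (Nat.cast_le (α := ℝ).2 h1) hc.le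
  have h5' := mul_le_mul_of_nonneg_right (Nat.cast_le (α := ℝ).2 h5) hc.le
  rw [mul_div_cancel₀ _ hM0.ne', Nat.cast_add, add_mul] at h5'
  rw [Nat.cast_add, Nat.cast_mul, add_mul, mul_assoc] at h1'
  have h3' := mul_le_mul_of_nonneg_left (h3.trans (add_le_add_left hW ε'))
    (Nat.cast_nonneg (α := ℝ) Q)
  rw [Real.dist_eq, abs_lt]
  constructor <;> linarith

/-- The limit ratio of `H`, as the proportion of arguments at which the amplitude is at most
`1 / 2`. -/
theorem hasLimitRatio_polyH (l : ℕ) :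
    HasLimitRatio (fun n => polyH l n)
      (volume.real {u ∈ Set.Icc 0 Real.pi | 2 * |dirichletAmplitude l u| ≤ 1} / Real.pi) := by
  have hpi := Real.pi_pos
  have hM : Filter.Tendsto (fun n : ℕ => ((2 * n + 2 * l : ℕ) : ℝ)) Filter.atTop Filter.atTop :=
    tendsto_natCast_atTop_atTop.comp
      (Filter.tendsto_atTop_mono (fun n => (by omega : n ≤ 2 * n + 2 * l)) Filter.tendsto_id)
  have hdeg : Filter.Tendsto (fun n : ℕ => 1 - (l : ℝ) / ((2 * n + 2 * l : ℕ) : ℝ))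
      Filter.atTop (nhds (1 - 0)) := tendsto_const_nhds.sub (hM.const_div_atTop _)
  have ht := ((tendsto_numZerosCircle_polyH l).div_const Real.pi).mul hdeg
  have hlim := ht.const_sub 1
  rw [HasLimitRatio]
  have e : volume.real {u ∈ Set.Icc 0 Real.pi | 2 * |dirichletAmplitude l u| ≤ 1} / Real.pi =
      1 - volume.real {u ∈ Set.Icc 0 Real.pi | 1 ≤ 2 * |dirichletAmplitude l u|} / Real.pi *
        (1 - 0) := by
    have := volume_add_volume_eq_pi l
    field_simp
    linarith
  rw [e]
  refine hlim.congr' ?_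
  filter_upwards [Filter.eventually_gt_atTop 0] with n hn
  have hz := numZeros_add (polyH l n)
  have hz' : (numZerosInside (polyH l n) : ℝ) + numZerosOutside (polyH l n) +
      numZerosCircle (polyH l n) = (polyH l n).natDegree := by exact_mod_cast hz
  rw [nonunimodularRatio, eq_sub_of_add_eq hz', natDegree_polyH (by omega)]
  have hn' : (0 : ℝ) < n := by exact_mod_cast hn
  have hl : (0 : ℝ) ≤ l := Nat.cast_nonneg l
  push_cast
  field_simp
  ring

/-! ### Bounds for the measure of the small-amplitude set -/

/-- The sum telescopes after multiplication by `2 sin (π / (2m))`. -/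
theorem sum_sin_eq {m : ℕ} (hm : 1 < m) :
    ∑ k ∈ Finset.range m, Real.sin (k * Real.pi / m) =
      Real.sin (((m : ℝ) - 1) * Real.pi / (2 * m)) / Real.sin (Real.pi / (2 * m)) := by
  have hm' : (1 : ℝ) < m := by exact_mod_cast hm
  have hpi := Real.pi_pos
  have hs : 0 < Real.sin (Real.pi / (2 * m)) := by
    refine Real.sin_pos_of_pos_of_lt_pi (by positivity) ?_
    rw [div_lt_iff₀ (by positivity)]; nlinarith
  rw [eq_div_iff hs.ne', Finset.sum_mul]
  have h : ∀ k ∈ Finset.range m,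
      Real.sin (k * Real.pi / m) * Real.sin (Real.pi / (2 * m)) =
        Real.cos ((2 * (k : ℕ) - 1) * Real.pi / (2 * m)) / 2 -
          Real.cos ((2 * ((k + 1 : ℕ) : ℝ) - 1) * Real.pi / (2 * m)) / 2 := by
    intro k _
    rw [show (2 * (k : ℝ) - 1) * Real.pi / (2 * m) = k * Real.pi / m - Real.pi / (2 * m) by
        field_simp,
      show (2 * ((k + 1 : ℕ) : ℝ) - 1) * Real.pi / (2 * m) =
        k * Real.pi / m + Real.pi / (2 * m) by push_cast; field_simp; ring,
      Real.cos_sub, Real.cos_add]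
    ring
  rw [Finset.sum_congr rfl h,
    Finset.sum_range_sub' (fun k : ℕ => Real.cos ((2 * (k : ℕ) - 1) * Real.pi / (2 * m)) / 2),
    show (2 * ((0 : ℕ) : ℝ) - 1) * Real.pi / (2 * m) = -(Real.pi / (2 * m)) by push_cast; ring,
    show (2 * (m : ℝ) - 1) * Real.pi / (2 * m) = Real.pi - Real.pi / (2 * m) by field_simp,
    show ((m : ℝ) - 1) * Real.pi / (2 * m) = Real.pi / 2 - Real.pi / (2 * m) by field_simp,
    Real.cos_neg, Real.cos_pi_sub, Real.sin_pi_div_two_sub]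
  ring

theorem abs_sin_mul_eq {m : ℕ} (hm : 0 < m) (k : ℕ) (v : ℝ) :
    |Real.sin (m * (k * Real.pi / m + v))| = |Real.sin (m * v)| := by
  have hm' : (0 : ℝ) < m := by exact_mod_cast hm
  rw [show (m : ℝ) * (k * Real.pi / m + v) = m * v + k * Real.pi by field_simp; ring,
    Real.sin_add_nat_mul_pi, abs_mul, abs_pow, abs_neg, abs_one, one_pow, one_mul]

/-- The chord of the sine over `[0, π / 6]`. -/
theorem three_div_pi_mul_le_sin {x : ℝ} (h0 : 0 ≤ x) (h1 : x ≤ Real.pi / 6) :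
    3 * x ≤ Real.pi * Real.sin x := by
  have hpi := Real.pi_pos
  have h := strictConcaveOn_sin_Icc.concaveOn.2
    (show (0 : ℝ) ∈ Set.Icc 0 Real.pi from ⟨le_rfl, hpi.le⟩)
    (show Real.pi / 6 ∈ Set.Icc 0 Real.pi from ⟨by linarith, by linarith⟩)
    (show 0 ≤ 1 - 6 * x / Real.pi by rw [sub_nonneg, div_le_one hpi]; linarith)
    (show 0 ≤ 6 * x / Real.pi by positivity) (by ring)
  rw [smul_eq_mul, smul_eq_mul, smul_eq_mul, smul_eq_mul, Real.sin_zero, Real.sin_pi_div_six,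
    show (1 - 6 * x / Real.pi) * 0 + 6 * x / Real.pi * (Real.pi / 6) = x by field_simp; ring] at h
  have h2 : (6 * x / Real.pi) * (1 / 2) * Real.pi ≤ Real.sin x * Real.pi := by
    gcongr; linarith
  rw [show 6 * x / Real.pi * (1 / 2) * Real.pi = 3 * x by field_simp; ring] at h2
  linarith

/-- A point where the amplitude is at most `1 / 2` is close to a zero `kπ/m` of `sin (m u)`. -/
theorem abs_sub_le_of_amplitude_le {l : ℕ} {u : ℝ} (hu : u ∈ Set.Icc 0 Real.pi)
    (h : 2 * |dirichletAmplitude l u| ≤ 1) :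
    ∃ k ∈ Finset.range (l + 1 + 1), |u - k * Real.pi / (l + 1 : ℕ)| ≤
      Real.pi * Real.sin (k * Real.pi / (l + 1 : ℕ)) /
        (6 * (l + 1 : ℕ) - Real.pi * |Real.cos (k * Real.pi / (l + 1 : ℕ))|) := by
  set m := l + 1 with hm
  have hm0 : (1 : ℝ) ≤ (m : ℝ) := by exact_mod_cast (by omega : 1 ≤ m)
  have hpi := Real.pi_pos
  have hpi4 := Real.pi_lt_four
  have hsu := Real.sin_nonneg_of_mem_Icc hu
  have hx0 : 0 ≤ m * u / Real.pi := by have := hu.1; positivity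
  -- `kπ/m` is the multiple of `π/m` nearest to `u`
  set k := ⌊m * u / Real.pi + 1 / 2⌋₊ with hk
  have hk1 := Nat.floor_le (a := m * u / Real.pi + 1 / 2) (by positivity)
  have hk2 := Nat.lt_floor_add_one (m * u / Real.pi + 1 / 2)
  rw [← hk] at hk1 hk2
  set a := k * Real.pi / m with ha
  set v := u - a with hv
  have hmv : |m * v| ≤ Real.pi / 2 := by
    have e : m * v = (m * u / Real.pi - k) * Real.pi := by
      rw [hv, ha]; field_simp
    rw [e, abs_le]
    constructor <;> nlinarith
  have hsin : 2 * |Real.sin (m * v)| ≤ Real.sin u := by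
    have h1 := dirichletAmplitude_mul_sin l u
    rw [show ((l : ℝ) + 1) = m by rw [hm]; push_cast; ring] at h1
    rw [← abs_sin_mul_eq (by omega) k v, ← ha, hv, add_sub_cancel, ← h1, abs_mul,
      abs_of_nonneg hsu]
    nlinarith
  have habs : |Real.sin (m * v)| = Real.sin |m * v| :=
    Real.abs_sin_eq_sin_abs_of_abs_le_pi (by linarith)
  have hsix : |m * v| ≤ Real.pi / 6 := by
    by_contra! hlt
    have := Real.sin_lt_sin_of_lt_of_le_pi_div_two (by linarith) hmv hlt
    rw [Real.sin_pi_div_six, ← habs] at this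
    linarith [Real.sin_le_one u]
  have hchord := three_div_pi_mul_le_sin (abs_nonneg _) hsix
  rw [← habs, abs_mul, abs_of_nonneg (by linarith : (0 : ℝ) ≤ m)] at hchord
  have hkm : k < m + 1 := by
    have h1 : m * u / Real.pi ≤ m := by
      rw [div_le_iff₀ hpi]; exact mul_le_mul_of_nonneg_left hu.2 (by linarith)
    have h2 : (k : ℝ) < ((m + 1 : ℕ) : ℝ) := by push_cast; linarith
    exact_mod_cast h2
  have hsa : 0 ≤ Real.sin a := by
    have h1 : (k : ℝ) ≤ m := by exact_mod_cast Nat.lt_add_one_iff.1 hkm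
    refine Real.sin_nonneg_of_mem_Icc ⟨by positivity, ?_⟩
    rw [ha, div_le_iff₀ (by linarith)]
    nlinarith
  have hadd : Real.sin u ≤ Real.sin a + |Real.cos a| * |v| := by
    rw [show u = a + v by rw [hv]; ring, Real.sin_add]
    have h1 : Real.sin a * Real.cos v ≤ Real.sin a := mul_le_of_le_one_right hsa (Real.cos_le_one v)
    have h2 : Real.cos a * Real.sin v ≤ |Real.cos a| * |v| := by
      refine (le_abs_self _).trans ?_
      rw [abs_mul]
      exact mul_le_mul_of_nonneg_left Real.abs_sin_le_abs (abs_nonneg _)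
    linarith
  refine ⟨k, Finset.mem_range.2 hkm, ?_⟩
  have hden : 0 < 6 * (m : ℝ) - Real.pi * |Real.cos a| := by
    nlinarith [Real.abs_cos_le_one a, abs_nonneg (Real.cos a)]
  rw [le_div_iff₀ hden]
  nlinarith

/-- Around a zero `a = kπ/m` of `sin (m u)`, the amplitude is at most `1 / 2` on an interval of
half-length proportional to `sin a`. -/
theorem amplitude_le_of_abs_sub_le {l k : ℕ} (hl : 1 ≤ l) (hk : k ≤ l) {u : ℝ}
    (h : |u - k * Real.pi / (l + 1 : ℕ)| ≤ Real.sin (k * Real.pi / (l + 1 : ℕ)) /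
        (2 * (l + 1 : ℕ) + (1 + 3 * |Real.cos (k * Real.pi / (l + 1 : ℕ))|) / 4))
    (hpos : 0 < Real.sin (k * Real.pi / (l + 1 : ℕ))) :
    u ∈ Set.Icc 0 Real.pi ∧ 2 * |dirichletAmplitude l u| ≤ 1 := by
  set m := l + 1 with hm
  have hm0 : (2 : ℝ) ≤ (m : ℝ) := by exact_mod_cast (by omega : 2 ≤ m)
  have hpi := Real.pi_pos
  set a := k * Real.pi / m with ha
  set v := u - a with hv
  -- `c` is less than one and leaves room for the quadratic error in `1 - v² / 2 ≤ cos v`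
  set c := (1 + 3 * |Real.cos a|) / 4 with hc
  have hc0 := abs_nonneg (Real.cos a)
  have hc1 := Real.abs_cos_le_one a
  have hcpos : 0 < c := by rw [hc]; positivity
  rw [le_div_iff₀ (by positivity)] at h
  have hv0 := abs_nonneg v
  have hvm : |v| * (2 * m) ≤ Real.sin a := by nlinarith
  have hv4 : |v| ≤ 1 / 4 := by nlinarith [Real.sin_le_one a]
  have hlow : Real.sin a - c * |v| ≤ Real.sin u := by
    rw [show u = a + v by rw [hv]; ring, Real.sin_add]
    have h1 := Real.one_sub_sq_div_two_le_cos (x := v)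
    have h2 : -(|Real.cos a| * |v|) ≤ Real.cos a * Real.sin v := by
      refine le_trans (neg_le_neg ?_) (neg_abs_le _)
      rw [abs_mul]
      exact mul_le_mul_of_nonneg_left Real.abs_sin_le_abs hc0
    have h3 : Real.sin a * (1 - v ^ 2 / 2) ≤ Real.sin a * Real.cos v :=
      mul_le_mul_of_nonneg_left h1 hpos.le
    -- `sin² a = (1 - |cos a|) (1 + |cos a|) ≤ 2 (1 - |cos a|)`
    have h4 : Real.sin a * Real.sin a ≤ 2 * (1 - |Real.cos a|) := by
      have := Real.sin_sq_add_cos_sq a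
      rw [← sq_abs (Real.cos a)] at this
      nlinarith
    have h5 : Real.sin a * v ^ 2 ≤ (1 - |Real.cos a|) / 2 * |v| := by
      rw [← sq_abs v]
      have h6 : |v| ≤ Real.sin a / 4 := by nlinarith
      have h7 : Real.sin a * |v| ≤ (1 - |Real.cos a|) / 2 := by nlinarith
      nlinarith
    rw [hc]
    nlinarith
  have hsu : 0 < Real.sin u := by
    rcases hv0.eq_or_lt with h0 | h0
    · rw [← h0] at hlow; linarith
    · nlinarith
  have hk1 : 1 ≤ k := by
    rcases Nat.eq_zero_or_pos k with h0 | h0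
    · rw [ha, h0] at hpos; simp at hpos
    · exact h0
  have hk1' : (1 : ℝ) ≤ k := by exact_mod_cast hk1
  have hkm : (k : ℝ) + 1 ≤ m := by exact_mod_cast (by omega : k + 1 ≤ m)
  have hma : m * a = k * Real.pi := by rw [ha]; field_simp
  have hmv : m * |v| ≤ 1 := by nlinarith [Real.sin_le_one a]
  have hvab := abs_le.1 (le_refl |v|)
  have hpi3 := Real.pi_gt_three
  refine ⟨⟨?_, ?_⟩, ?_⟩
  · have : 0 ≤ m * u := by
      have : m * u = m * a + m * v := by rw [hv]; ring
      nlinarith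
    exact nonneg_of_mul_nonneg_right this (by linarith)
  · have : m * u ≤ m * Real.pi := by
      have : m * u = m * a + m * v := by rw [hv]; ring
      nlinarith
    exact le_of_mul_le_mul_left this (by linarith)
  · have h1 := dirichletAmplitude_mul_sin l u
    rw [show ((l : ℝ) + 1) = m by rw [hm]; push_cast; ring] at h1
    have h2 : |Real.sin (m * u)| ≤ m * |v| := by
      rw [show u = a + v by rw [hv]; ring, ha, abs_sin_mul_eq (by omega)]
      refine Real.abs_sin_le_abs.trans ?_
      rw [abs_mul, abs_of_nonneg (by linarith : (0 : ℝ) ≤ m)]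
    rw [← h1, abs_mul, abs_of_pos hsu] at h2
    have h3 : 2 * |dirichletAmplitude l u| * Real.sin u ≤ 1 * Real.sin u := by nlinarith
    exact le_of_mul_le_mul_right h3 hsu

theorem sin_mul_pi_div_pos {m k : ℕ} (hk : 0 < k) (hkm : k < m) :
    0 < Real.sin (k * Real.pi / m) := by
  have hpi := Real.pi_pos
  have hk' : (0 : ℝ) < k := by exact_mod_cast hk
  have hkm' : (k : ℝ) < m := by exact_mod_cast hkm
  refine Real.sin_pos_of_pos_of_lt_pi (div_pos (by positivity) (by linarith)) ?_
  rw [div_lt_iff₀ (by linarith)]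
  nlinarith

theorem abs_cos_lt_one_of_sin_pos {x : ℝ} (hx : 0 < Real.sin x) : |Real.cos x| < 1 := by
  rw [← sq_lt_one_iff_abs_lt_one]
  nlinarith [Real.sin_sq_add_cos_sq x]

/-- The set where the amplitude is at most `1 / 2` is covered by intervals around the points
`kπ/m`. The bound is strict because `|cos (π/m)| < 1`. -/
theorem volume_amplitude_le_lt {l : ℕ} (hl : 1 ≤ l) :
    volume.real {u ∈ Set.Icc 0 Real.pi | 2 * |dirichletAmplitude l u| ≤ 1} <
      2 * Real.pi / (6 * (l + 1 : ℕ) - Real.pi) *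
        ∑ k ∈ Finset.range (l + 1), Real.sin (k * Real.pi / (l + 1 : ℕ)) := by
  set m := l + 1 with hm
  have hm0 : (2 : ℝ) ≤ (m : ℝ) := by exact_mod_cast (by omega : 2 ≤ m)
  have hpi := Real.pi_pos
  have hpi4 := Real.pi_lt_four
  set w : ℕ → ℝ := fun k => Real.pi * Real.sin (k * Real.pi / m) /
    (6 * m - Real.pi * |Real.cos (k * Real.pi / m)|) with hw
  have hden : ∀ x : ℝ, 6 * (m : ℝ) - Real.pi ≤ 6 * m - Real.pi * |Real.cos x| := fun x => by
    nlinarith [Real.abs_cos_le_one x]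
  have hden0 : 0 < 6 * (m : ℝ) - Real.pi := by linarith
  have hsin : ∀ k ∈ Finset.range (m + 1), 0 ≤ Real.sin (k * Real.pi / m) := by
    intro k hk
    have h1 : (k : ℝ) ≤ m := by
      exact_mod_cast Nat.lt_add_one_iff.1 (Finset.mem_range.1 hk)
    refine Real.sin_nonneg_of_mem_Icc ⟨by positivity, ?_⟩
    rw [div_le_iff₀ (by linarith)]
    nlinarith
  have hsub : {u ∈ Set.Icc 0 Real.pi | 2 * |dirichletAmplitude l u| ≤ 1} ⊆
      ⋃ k ∈ Finset.range (m + 1), Set.Icc (k * Real.pi / m - w k) (k * Real.pi / m + w k) := by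
    intro u hu
    obtain ⟨k, hk, h⟩ := abs_sub_le_of_amplitude_le hu.1 hu.2
    have := abs_le.1 h
    simp only [Set.mem_iUnion]
    exact ⟨k, hk, by linarith [this.1], by linarith [this.2]⟩
  have hvol : ∀ k ∈ Finset.range (m + 1),
      volume.real (Set.Icc (k * Real.pi / m - w k) (k * Real.pi / m + w k)) = 2 * w k := by
    intro k hk
    have : 0 ≤ w k := div_nonneg (mul_nonneg hpi.le (hsin k hk)) (hden0.le.trans (hden _))
    rw [Real.volume_real_Icc_of_le (by linarith)]
    ring
  have hle : ∀ k ∈ Finset.range (m + 1),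
      2 * w k ≤ 2 * Real.pi / (6 * m - Real.pi) * Real.sin (k * Real.pi / m) := by
    intro k hk
    have h1 : w k ≤ Real.pi * Real.sin (k * Real.pi / m) / (6 * m - Real.pi) :=
      div_le_div_of_nonneg_left (mul_nonneg hpi.le (hsin k hk)) hden0 (hden _)
    calc 2 * w k ≤ 2 * (Real.pi * Real.sin (k * Real.pi / m) / (6 * m - Real.pi)) := by linarith
      _ = _ := by ring
  have hlt : 2 * w 1 <
      2 * Real.pi / (6 * m - Real.pi) * Real.sin ((1 : ℕ) * Real.pi / m) := by
    have hs := sin_mul_pi_div_pos (m := m) one_pos (by omega)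
    have hc := abs_cos_lt_one_of_sin_pos hs
    have h1 : w 1 < Real.pi * Real.sin ((1 : ℕ) * Real.pi / m) / (6 * m - Real.pi) :=
      div_lt_div_of_pos_left (mul_pos hpi hs) hden0 (by nlinarith)
    calc 2 * w 1 < 2 * (Real.pi * Real.sin ((1 : ℕ) * Real.pi / m) / (6 * m - Real.pi)) := by
          linarith
      _ = _ := by ring
  calc volume.real {u ∈ Set.Icc 0 Real.pi | 2 * |dirichletAmplitude l u| ≤ 1}
      ≤ volume.real (⋃ k ∈ Finset.range (m + 1),
          Set.Icc (k * Real.pi / m - w k) (k * Real.pi / m + w k)) :=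
        measureReal_mono hsub ((Finset.range (m + 1)).isCompact_biUnion
          fun _ _ => isCompact_Icc).measure_lt_top.ne
    _ ≤ ∑ k ∈ Finset.range (m + 1),
          volume.real (Set.Icc (k * Real.pi / m - w k) (k * Real.pi / m + w k)) :=
        measureReal_biUnion_finset_le _ _
    _ = ∑ k ∈ Finset.range (m + 1), 2 * w k := Finset.sum_congr rfl hvol
    _ < ∑ k ∈ Finset.range (m + 1),
          2 * Real.pi / (6 * m - Real.pi) * Real.sin (k * Real.pi / m) :=
        Finset.sum_lt_sum hle ⟨1, Finset.mem_range.2 (by omega), hlt⟩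
    _ = _ := by
        rw [← Finset.mul_sum, Finset.sum_range_succ, mul_div_cancel_left₀ _ (by linarith),
          Real.sin_pi, add_zero]

/-- The set where the amplitude is at most `1 / 2` contains disjoint intervals around the points
`kπ/m`. The bound is strict because `|cos (π/m)| < 1`. -/
theorem lt_volume_amplitude_le {l : ℕ} (hl : 1 ≤ l) :
    2 / (2 * (l + 1 : ℕ) + 1) * ∑ k ∈ Finset.range (l + 1), Real.sin (k * Real.pi / (l + 1 : ℕ)) <
      volume.real {u ∈ Set.Icc 0 Real.pi | 2 * |dirichletAmplitude l u| ≤ 1} := by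
  set m := l + 1 with hm
  have hm0 : (2 : ℝ) ≤ (m : ℝ) := by exact_mod_cast (by omega : 2 ≤ m)
  have hpi := Real.pi_pos
  set r : ℕ → ℝ := fun k => Real.sin (k * Real.pi / m) /
    (2 * m + (1 + 3 * |Real.cos (k * Real.pi / m)|) / 4) with hr
  have hden0 : ∀ x : ℝ, 0 < 2 * (m : ℝ) + (1 + 3 * |Real.cos x|) / 4 := fun x => by positivity
  have hden : ∀ x : ℝ, 2 * (m : ℝ) + (1 + 3 * |Real.cos x|) / 4 ≤ 2 * m + 1 := fun x => by
    linarith [Real.abs_cos_le_one x]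
  have hsin : ∀ k ∈ Finset.range m, 0 ≤ Real.sin (k * Real.pi / m) := by
    intro k hk
    rcases Nat.eq_zero_or_pos k with h0 | h0
    · rw [h0]; simp
    · exact (sin_mul_pi_div_pos h0 (Finset.mem_range.1 hk)).le
  have hr0 : ∀ k ∈ Finset.range m, 0 ≤ r k := fun k hk => div_nonneg (hsin k hk) (hden0 _).le
  -- half-open intervals, because the one with index `0` has to be empty
  have hsub : (⋃ k ∈ Finset.range m, Set.Ico (k * Real.pi / m - r k) (k * Real.pi / m + r k)) ⊆
      {u ∈ Set.Icc 0 Real.pi | 2 * |dirichletAmplitude l u| ≤ 1} := by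
    intro u hu
    simp only [Set.mem_iUnion] at hu
    obtain ⟨k, hk, hu⟩ := hu
    refine amplitude_le_of_abs_sub_le hl (Nat.lt_add_one_iff.1 (Finset.mem_range.1 hk))
      (abs_le.2 ⟨by linarith [hu.1], by linarith [hu.2]⟩) ?_
    refine (hsin k hk).lt_of_ne fun h0 => ?_
    have h1 : r k = 0 := by rw [hr]; simp only [← h0, zero_div]
    rw [h1] at hu
    linarith [hu.1, hu.2]
  have hdisj : Set.PairwiseDisjoint (↑(Finset.range m) : Set ℕ) fun k : ℕ =>
      Set.Ico (k * Real.pi / m - r k) (k * Real.pi / m + r k) := by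
    have hmono : Monotone fun k : ℕ => (2 * (k : ℝ) - 1) * Real.pi / (2 * m) := by
      intro a b hab
      have : (a : ℝ) ≤ b := by exact_mod_cast hab
      dsimp only; gcongr
    have hrle : ∀ k, r k ≤ Real.pi / (2 * m) := by
      intro k
      have h1 : r k ≤ 1 / (2 * m) :=
        div_le_div₀ zero_le_one (Real.sin_le_one _) (by positivity)
          (le_add_of_nonneg_right (by positivity))
      refine h1.trans ?_
      have := Real.pi_gt_three
      gcongr; linarith
    intro i _ j _ hij
    refine (hmono.pairwise_disjoint_on_Ico_succ hij).mono ?_ ?_ <;>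
    · refine Set.Ico_subset_Ico ?_ ?_
      · rw [show ∀ k : ℝ, (2 * k - 1) * Real.pi / (2 * m) = k * Real.pi / m - Real.pi / (2 * m) from
          fun k => by field_simp]
        linarith [hrle i, hrle j]
      · rw [Order.succ_eq_add_one, show ∀ k : ℕ, (2 * ((k + 1 : ℕ) : ℝ) - 1) * Real.pi / (2 * m) =
          k * Real.pi / m + Real.pi / (2 * m) from fun k => by
            rw [Nat.cast_add_one k]; field_simp; ring]
        linarith [hrle i, hrle j]
  have hvol : ∀ k ∈ Finset.range m,
      volume.real (Set.Ico (k * Real.pi / m - r k) (k * Real.pi / m + r k)) = 2 * r k := by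
    intro k hk
    rw [Real.volume_real_Ico_of_le (by linarith [hr0 k hk])]
    ring
  have hle : ∀ k ∈ Finset.range m,
      2 / (2 * (m : ℝ) + 1) * Real.sin (k * Real.pi / m) ≤ 2 * r k := by
    intro k hk
    have h1 : Real.sin (k * Real.pi / m) / (2 * m + 1) ≤ r k :=
      div_le_div_of_nonneg_left (hsin k hk) (hden0 _) (hden _)
    calc _ = 2 * (Real.sin (k * Real.pi / m) / (2 * m + 1)) := by ring
      _ ≤ _ := by linarith
  have hlt : 2 / (2 * (m : ℝ) + 1) * Real.sin ((1 : ℕ) * Real.pi / m) < 2 * r 1 := by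
    have hs := sin_mul_pi_div_pos (m := m) one_pos (by omega)
    have hc := abs_cos_lt_one_of_sin_pos hs
    have h1 : Real.sin ((1 : ℕ) * Real.pi / m) / (2 * m + 1) < r 1 :=
      div_lt_div_of_pos_left hs (hden0 _) (by linarith)
    calc _ = 2 * (Real.sin ((1 : ℕ) * Real.pi / m) / (2 * m + 1)) := by ring
      _ < _ := by linarith
  calc _ = ∑ k ∈ Finset.range m, 2 / (2 * (m : ℝ) + 1) * Real.sin (k * Real.pi / m) :=
        Finset.mul_sum _ _ _
    _ < ∑ k ∈ Finset.range m, 2 * r k :=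
        Finset.sum_lt_sum hle ⟨1, Finset.mem_range.2 (by omega), hlt⟩
    _ = ∑ k ∈ Finset.range m,
          volume.real (Set.Ico (k * Real.pi / m - r k) (k * Real.pi / m + r k)) :=
        (Finset.sum_congr rfl hvol).symm
    _ = volume.real (⋃ k ∈ Finset.range m,
          Set.Ico (k * Real.pi / m - r k) (k * Real.pi / m + r k)) :=
        (measureReal_biUnion_finset hdisj (fun _ _ => measurableSet_Ico)
          (fun _ _ => measure_Ico_lt_top.ne)).symm
    _ ≤ _ := measureReal_mono hsub
        (isCompact_amplitude_mem (isClosed_Iic (a := 1))).measure_lt_top.ne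

/-! ### The Boyd--Mossinghoff polynomial -/

theorem X_pow_mul_polyH (l n : ℕ) :
    X ^ l * polyH l n = (boydMossinghoff (l + 1) 1).eval ((X : ℤ[X]) ^ (n + l)) := by
  have h1 : polyH l n = X ^ (2 * n + l) * phiBM (l + 1) + phiBM (l + 1) + X ^ (n + l) := by
    have h2 : ∑ j ∈ Finset.range (l + 1), (X : ℤ[X]) ^ ((n + l) - (n + j)) = phiBM (l + 1) := by
      rw [phiBM, ← Finset.sum_range_reflect]
      refine Finset.sum_congr rfl fun j hj => ?_
      have := Finset.mem_range.1 hj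
      congr 1; omega
    rw [polyH, Finset.sum_add_distrib, h2, phiBM, Finset.mul_sum]
    congr 2
    refine Finset.sum_congr rfl fun j _ => ?_
    rw [← pow_add]
    congr 1; ring
  have h3 : phiBM 1 = 1 := by simp [phiBM]
  rw [h1, boydMossinghoff, h3]
  simp only [eval_add, eval_mul, eval_C, eval_pow, eval_X, Nat.add_sub_cancel,
    show 1 - (l + 1) = 0 by omega, pow_zero]
  ring

/-! ### Existence and bounds of the limit ratio -/

theorem mainTheorem3 (m : ℕ) (hm : 1 < m) :
    (∀ n : ℕ, X ^ (m - 1) * polyH (m - 1) n =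
      (boydMossinghoff m 1).eval ((X : ℤ[X]) ^ (n + (m - 1)))) ∧
    ∃ L : ℝ, HasLimitRatio (fun n => polyH (m - 1) n) L ∧
      2 / (Real.pi * (2 * (m : ℝ) + 1)) *
          (Real.sin (((m : ℝ) - 1) * Real.pi / (2 * (m : ℝ))) /
            Real.sin (Real.pi / (2 * (m : ℝ)))) < L ∧
      L < 2 / (6 * (m : ℝ) - Real.pi) *
          (Real.sin (((m : ℝ) - 1) * Real.pi / (2 * (m : ℝ))) /
            Real.sin (Real.pi / (2 * (m : ℝ)))) := by
  obtain ⟨l, rfl⟩ : ∃ l, m = l + 1 := ⟨m - 1, by omega⟩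
  have hpi := Real.pi_pos
  have hl : 1 ≤ l := by omega
  rw [Nat.add_sub_cancel, ← sum_sin_eq hm]
  refine ⟨X_pow_mul_polyH l, _, hasLimitRatio_polyH l, ?_, ?_⟩
  · rw [lt_div_iff₀ hpi]
    refine lt_of_eq_of_lt ?_ (lt_volume_amplitude_le hl)
    field_simp
  · rw [div_lt_iff₀ hpi]
    refine (volume_amplitude_le_lt hl).trans_eq ?_
    ring
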